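/- Let ${\boldsymbol k}=k_1\cdots k_L\in\{0,1\}^L$ ($L\ge 1$) be a binary word (the "unique word"). Say that a word $a$ is an internal subword of a word $w$ if $w=xay$ with $x,y$ both non-empty. Let ${\cal C}_{\boldsymbol k}(0)=\{\text{null}\}$ and, for $n\ge 1$, let ${\cal C}_{\boldsymbol k}(n)$ be the set of binary words $b$ of length $n$ such that ${\boldsymbol k}$ is not an internal subword of ${\boldsymbol k}b{\boldsymbol k}$. Put ${\cal C}_{\boldsymbol k}=\bigcup_{n\ge 0}{\cal C}_{\boldsymbol k}(n)$, $c_n=|{\cal C}_{\boldsymbol k}(n)|$, $F_n=\sum_{j=0}^{n}c_j$ ($F_{-1}=0$), and $g_{\boldsymbol k}=\lim_{n\to\infty}c_{n+1}/c_n$. Let $U$ be a finite alphabet with letter probabilities $p_u\ge 0$, $\sum_u p_u=1$, and $p_u<1$ for all $u$ (a nontrivial source), and let $\mathrm H({\cal U})=\sum_u p_u\log_2(1/p_u)$. For $t\ge 1$ give the block $(u_1,\dots,u_t)\in U^t$ the probability $p_{u_1}\cdots p_{u_t}$ (i.i.d. source). Enumerate $U^t$ in order of non-increasing probability as $v_1,\dots,v_{|U|^t}$,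 and let $\phi$ be an optimal encoder, that is, an injective map $U^t\to{\cal C}_{\boldsymbol k}$ such that $\phi(v_i)$ has the length $n$ with $F_{n-1}<i\le F_n$. Let $$L_{{\boldsymbol k},t}=\frac1t\Big(L+\sum_{v\in U^t}\Pr(v)\,\ell(\phi(v))\Big),$$ where $\ell$ denotes the length of a word (this does not depend on the choice of the enumeration and of $\phi$). (a) Suppose $g_{\boldsymbol k}>1$. Then the limit that defines $g_{\boldsymbol k}$ exists, optimal encoders exist for every $t$, the limit of $L_{{\boldsymbol k},t}$ as $t\to\infty$ exists, and $$\lim_{t\to\infty}L_{{\boldsymbol k},t}\ \le\ \frac{\mathrm H({\cal U})}{\log_2 g_{\boldsymbol k}}\ \le\ \frac{\mathrm H({\cal U})}{\log_2(2-2^{2-L})},$$ where the second inequality is for $L\ge 3$ (for $L=2$ its right-hand side is read as $+\infty$, and $g_{\boldsymbol k}>1$ does not occur for $L=1$). (b) Hence the entropy rate is achievable: $$\lim_{L\to\infty}\ \lim_{t\to\infty}L_{{\boldsymbol k},t}=\mathrm H({\cal U}),$$ uniformly over the words ${\boldsymbol k}$ of length $L$; that is, for every $\varepsilon>0$ there is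 $L_0$ such that for every ${\boldsymbol k}$ of length at least $L_0$ optimal encoders exist for every $t$ and $\lim_{t\to\infty}L_{{\boldsymbol k},t}$ exists and differs from $\mathrm H({\cal U})$ by less than $\varepsilon$. -/

import Mathlib

open Filter Topology

noncomputable section

namespace UDOOC

/-- `a` is an internal subword of `w`: it occurs in `w` as a block of consecutive bits which is
neither a prefix occurrence nor a suffix occurrence. -/
def IsInternalSubword (a w : List Bool) : Prop :=
  ∃ x y : List Bool, x ≠ [] ∧ y ≠ [] ∧ w = x ++ a ++ y

/-- The length-`n` codewords for the unique word `k`: for `n = 0` only the null word, and for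
`n ≥ 1` the words `b` of length `n` such that `k` is not an internal subword of `k b k`. -/
def codeOfLength (k : List Bool) (n : ℕ) : Set (List Bool) :=
  {b | b.length = n ∧ (n = 0 ∨ ¬ IsInternalSubword k (k ++ b ++ k))}

/-- The uniquely decodable one-to-one code with unique word `k`. -/
def code (k : List Bool) : Set (List Bool) := ⋃ n : ℕ, codeOfLength k n

/-- The number of codewords of length `n`. -/
def numCodewords (k : List Bool) (n : ℕ) : ℕ := (codeOfLength k n).ncard

/-- The asymptotic growth rate, the limit of `c (n + 1) / c n`. -/
def growthRate (k : List Bool) : ℝ :=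
  limUnder atTop (fun n : ℕ => (numCodewords k (n + 1) : ℝ) / (numCodewords k n : ℝ))

/-- `φ` is an optimal encoding map into the code with unique word `k` for a source with alphabet
`A` and letter probabilities `q`: it is one-to-one into the code and, for some enumeration
`u 0, u 1, …` of the alphabet in order of non-increasing probability, the codeword of `u i` has
the length `n` with `∑ j < n, c j ≤ i < ∑ j ≤ n, c j` (the index `i` starts at `0`). -/
def IsOptimalEncoder {A : Type*} [Fintype A] (k : List Bool) (q : A → ℝ)
    (φ : A → List Bool) : Prop :=
  Function.Injective φ ∧ (∀ a, φ a ∈ code k) ∧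
    ∃ u : Fin (Fintype.card A) ≃ A, Antitone (fun i => q (u i)) ∧
      ∀ i : Fin (Fintype.card A),
        ∑ j ∈ Finset.range (φ (u i)).length, numCodewords k j ≤ (i : ℕ) ∧
        (i : ℕ) < ∑ j ∈ Finset.range ((φ (u i)).length + 1), numCodewords k j

/-- The average codeword length of the encoding map `φ`, the inserted unique word included. -/
def avgLength {A : Type*} [Fintype A] (k : List Bool) (q : A → ℝ) (φ : A → List Bool) : ℝ :=
  (k.length : ℝ) + ∑ a, q a * ((φ a).length : ℝ)

/-- The distribution of a block of `t` letters of the i.i.d. source with letter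
probabilities `p`. -/
def blockProb {U : Type*} (p : U → ℝ) (t : ℕ) : (Fin t → U) → ℝ :=
  fun u => ∏ i, p (u i)

/-- The entropy in bits. -/
def entropy {U : Type*} [Fintype U] (p : U → ℝ) : ℝ := ∑ u, p u * Real.logb 2 (1 / p u)

/-- The per-letter average codeword length of optimal encoding of `t`-letter blocks converges to
`l` as `t → ∞`. Optimal encoding maps exist for every `t`, and the convergence holds for every
choice of them. -/
def PerLetterLengthTendsto {U : Type*} [Fintype U] (k : List Bool) (p : U → ℝ) (l : ℝ) : Prop :=
  (∀ t : ℕ, ∃ φ : (Fin t → U) → List Bool, IsOptimalEncoder k (blockProb p t) φ) ∧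
  ∀ φ : (t : ℕ) → (Fin t → U) → List Bool,
    (∀ t, IsOptimalEncoder k (blockProb p t) (φ t)) →
    Tendsto (fun t : ℕ => avgLength k (blockProb p t) (φ t) / (t : ℝ)) atTop (𝓝 l)

end UDOOC

end

/-! Let a(n) count the words of length n without `k`. Everything is transferred to this sequence,
and the limit in (a) turns out to equal H / log₂ g, with g the growth rate.

Existence of g. Counting the extensions of a prefix gives a two-term branching recursion over
prefixes. Let `e` be the complement of the last letter of `k`. A run of `k.length` letters `e`
erases the past, so this one state is reached from every prefix that avoids `k`. If it also carries
a fixed share of all continuations, the interval containing all ratios shrinks geometrically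
(`exists_tendsto_ratio`). `hasAvoidRate` checks the share by the shape of `k`; only the words `[e,
!e]` fail, and there a(n) = n + 1.

From a(n) to codewords. Prepending a letter to words whose only occurrence of `k` is terminal gives
c(n) = 4a(N) - 4a(N+1) + a(N+2) with N = n + 2L - 2. Hence c(n) / a(N) tends to (2 - g)², which is
nonzero by `rate_lt_two`, and c has the same ratio limit. The bound g ≥ 2 - 2^(2-L) is
`mul_avoidCount_le`.

Coding. Cumulated counts grow like g^n up to subexponential factors, so the codeword of rank i has
length about log₂ i / log₂ g. The mean of log₂ of the rank is at most the entropy, and falls short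
of it by at most log₂(1 + log N) for N symbols. For blocks N = |U|^t, so the gap is O(log t) and
vanishes per letter. Part (b) follows from 2 - 2^(2-L) ≤ g < 2. -/

namespace UDOOC

/-! ### Ratio limits for two-term branching recursions -/

section RatioLimit

variable {S : Type*} {v : S → ℕ → ℝ} {α β : S → S}

/-- All the sequences `v s` have consecutive ratios in `[m, M]` at the index `n`. -/
def RatioBounds (v : S → ℕ → ℝ) (m M : ℝ) (n : ℕ) : Prop :=
  ∀ s, m * v s n ≤ v s (n + 1) ∧ v s (n + 1) ≤ M * v s n

lemma RatioBounds.succ (hv : ∀ s n, v s (n + 1) = v (α s) n + v (β s) n) {m M : ℝ} {n : ℕ}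
    (h : RatioBounds v m M n) : RatioBounds v m M (n + 1) := by
  intro s
  rw [hv s (n + 1), hv s n]
  constructor <;> linarith [(h (α s)).1, (h (β s)).1, (h (α s)).2, (h (β s)).2]

lemma RatioBounds.mono_index (hv : ∀ s n, v s (n + 1) = v (α s) n + v (β s) n) {m M : ℝ} {n n' : ℕ}
    (h : RatioBounds v m M n) (hn : n ≤ n') : RatioBounds v m M n' := by
  induction n', hn using Nat.le_induction with
  | base => exact h
  | succ j _ ih => exact ih.succ hv

/-- Following `α` for `j` steps and removing the end state leaves the sum of the `β`-branches split
off on the way. Each is taken at an index at least `n`, so the ratio bounds apply to it. -/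
lemma RatioBounds.sub_iterate (hv : ∀ s n, v s (n + 1) = v (α s) n + v (β s) n) {m M : ℝ} {n : ℕ}
    (h : RatioBounds v m M n) (j : ℕ) (s : S) :
    m * (v s (n + j) - v (α^[j] s) n) ≤ v s (n + j + 1) - v (α^[j] s) (n + 1) ∧
      v s (n + j + 1) - v (α^[j] s) (n + 1) ≤ M * (v s (n + j) - v (α^[j] s) n) := by
  induction j generalizing s with
  | zero => simp
  | succ j ih =>
    have h1 := ih (α s)
    have h2 := h.mono_index hv (Nat.le_add_right n j) (β s)
    rw [Function.iterate_succ_apply, ← add_assoc n j 1, hv s (n + j), hv s (n + j + 1)]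
    constructor <;> linarith [h1.1, h1.2, h2.1, h2.2]

lemma RatioBounds.contract (hv : ∀ s n, v s (n + 1) = v (α s) n + v (β s) n)
    {s₀ : S} {L : ℕ}
    (hmark : ∀ s, (∀ n, v s n = 0) ∨ ∀ n, v (α^[L] s) n = v s₀ n)
    (hpos : ∀ n, 0 < v s₀ n) {δ : ℝ} (hδ : ∀ s n, δ * v s (n + L) ≤ v s₀ n)
    {m M : ℝ} {n : ℕ} (h : RatioBounds v m M n) :
    ∃ m' M', RatioBounds v m' M' (n + L) ∧ M' - m' = (1 - δ) * (M - m) := by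
  obtain ⟨hm, hM⟩ := h s₀
  have hb := hpos n
  obtain ⟨ρ, hρ⟩ : ∃ ρ, v s₀ (n + 1) = ρ * v s₀ n := ⟨v s₀ (n + 1) / v s₀ n, by field_simp⟩
  rw [hρ] at hm hM
  have hm' : m ≤ ρ := le_of_mul_le_mul_right hm hb
  have hM' : ρ ≤ M := le_of_mul_le_mul_right hM hb
  -- A share at least `δ` of `v s (n + L)` is `v s₀ n`, whose ratio is exactly `ρ`; the rest has
  -- ratio in `[m, M]`. So the new interval is `δρ + (1 - δ)[m, M]`.
  refine ⟨m + δ * (ρ - m), M - δ * (M - ρ), fun s => ?_, by ring⟩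
  rcases hmark s with hs | hs
  · simp [hs]
  · have key := h.sub_iterate hv L s
    rw [hs, hs, hρ] at key
    have hd := hδ s n
    constructor
    · nlinarith [mul_le_mul_of_nonneg_left hd (sub_nonneg.2 hm'), key.1]
    · nlinarith [mul_le_mul_of_nonneg_left hd (sub_nonneg.2 hM'), key.2]

/-- Ratio limit theorem for a family of nonnegative sequences that satisfies a two-term branching
recursion, where the state `s₀` is reached from every state in `L` steps and dominates. -/
theorem exists_tendsto_ratio (hv : ∀ s n, v s (n + 1) = v (α s) n + v (β s) n)
    (h0 : ∀ s n, 0 ≤ v s n) (h1 : ∀ s, v s 1 ≤ 2 * v s 0) {s₀ : S} {L : ℕ}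
    (hmark : ∀ s, (∀ n, v s n = 0) ∨ ∀ n, v (α^[L] s) n = v s₀ n)
    (hpos : ∀ n, 0 < v s₀ n) {δ : ℝ} (hδ0 : 0 < δ) (hδ1 : δ ≤ 1)
    (hδ : ∀ s n, δ * v s (n + L) ≤ v s₀ n) :
    ∃ g : ℝ, ∀ s, (∀ n, 0 < v s n) → Tendsto (fun n => v s (n + 1) / v s n) atTop (𝓝 g) := by
  have hbd : ∀ j : ℕ, ∃ m M, RatioBounds v m M (j * L) ∧ M - m = (1 - δ) ^ j * 2 := by
    intro j
    induction j with
    | zero => exact ⟨0, 2, fun s => ⟨by simpa using h0 s _, by simpa using h1 s⟩, by simp⟩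
    | succ j ih =>
      obtain ⟨m, M, hr, hmM⟩ := ih
      obtain ⟨m', M', hr', h'⟩ := hr.contract hv hmark hpos hδ
      exact ⟨m', M', by rwa [Nat.succ_mul], by rw [h', hmM]; ring⟩
  choose m M hr hgap using hbd
  have hmem : ∀ s, (∀ n, 0 < v s n) → ∀ j n, j * L ≤ n →
      m j ≤ v s (n + 1) / v s n ∧ v s (n + 1) / v s n ≤ M j := by
    intro s hs j n hn
    have := (hr j).mono_index hv hn s
    exact ⟨(le_div_iff₀ (hs n)).2 this.1, (div_le_iff₀ (hs n)).2 this.2⟩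
  have hlim : Tendsto (fun j : ℕ => (1 - δ) ^ j * 2) atTop (𝓝 0) := by
    simpa using (tendsto_pow_atTop_nhds_zero_of_lt_one (by linarith : 0 ≤ 1 - δ)
      (by linarith)).mul_const 2
  have hsmall : ∀ ε > 0, ∃ j, M j - m j < ε := by
    intro ε hε
    obtain ⟨j, hj⟩ := (hlim.eventually (gt_mem_nhds hε)).exists
    exact ⟨j, by rw [hgap]; exact hj⟩
  have hcauchy : CauchySeq (fun n => v s₀ (n + 1) / v s₀ n) := by
    refine Metric.cauchySeq_iff'.2 fun ε hε => ?_
    obtain ⟨j, hj⟩ := hsmall ε hε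
    refine ⟨j * L, fun n hn => ?_⟩
    have ha := hmem s₀ hpos j n hn
    have hb := hmem s₀ hpos j (j * L) le_rfl
    rw [Real.dist_eq, abs_lt]
    constructor <;> linarith [ha.1, ha.2, hb.1, hb.2]
  obtain ⟨g, hg⟩ := cauchySeq_tendsto_of_complete hcauchy
  have hgm : ∀ j, m j ≤ g ∧ g ≤ M j := fun j =>
    ⟨ge_of_tendsto hg (eventually_atTop.2 ⟨j * L, fun n hn => (hmem s₀ hpos j n hn).1⟩),
      le_of_tendsto hg (eventually_atTop.2 ⟨j * L, fun n hn => (hmem s₀ hpos j n hn).2⟩)⟩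
  refine ⟨g, fun s hs => Metric.tendsto_atTop.2 fun ε hε => ?_⟩
  obtain ⟨j, hj⟩ := hsmall ε hε
  refine ⟨j * L, fun n hn => ?_⟩
  have ha := hmem s hs j n hn
  have hb := hgm j
  rw [Real.dist_eq, abs_lt]
  constructor <;> linarith [ha.1, ha.2, hb.1, hb.2]

end RatioLimit

/-! ### Counting binary words -/

/-- The number of binary words of length `n` with the property `P`. -/
noncomputable def wordCount (P : List Bool → Prop) (n : ℕ) : ℕ := {b | b.length = n ∧ P b}.ncard

section WordCount

variable {P Q R : List Bool → Prop} {n : ℕ}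

lemma finite_words (P : List Bool → Prop) (n : ℕ) : {b : List Bool | b.length = n ∧ P b}.Finite :=
  (List.finite_length_eq Bool n).subset fun _ h => h.1

lemma wordCount_mono (h : ∀ b, b.length = n → P b → Q b) : wordCount P n ≤ wordCount Q n :=
  Set.ncard_le_ncard (fun b hb => ⟨hb.1, h b hb.1 hb.2⟩) (finite_words Q n)

lemma wordCount_congr (h : ∀ b, b.length = n → (P b ↔ Q b)) : wordCount P n = wordCount Q n :=
  le_antisymm (wordCount_mono fun b hb => (h b hb).1) (wordCount_mono fun b hb => (h b hb).2)

lemma wordCount_eq_add (h : ∀ b, b.length = n → (P b ↔ Q b ∨ R b))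
    (hd : ∀ b, b.length = n → Q b → ¬ R b) : wordCount P n = wordCount Q n + wordCount R n := by
  unfold wordCount
  rw [← Set.ncard_union_eq _ (finite_words Q n) (finite_words R n)]
  · congr 1
    ext b
    simp only [Set.mem_ofPred_eq, Set.mem_union]
    constructor
    · rintro ⟨hb, hP⟩
      exact ((h b hb).1 hP).imp (⟨hb, ·⟩) (⟨hb, ·⟩)
    · rintro (⟨hb, hQ⟩ | ⟨hb, hR⟩)
      exacts [⟨hb, (h b hb).2 (.inl hQ)⟩, ⟨hb, (h b hb).2 (.inr hR)⟩]
  · exact Set.disjoint_left.2 fun b hb hb' => hd b hb.1 hb.2 hb'.2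

lemma wordCount_eq_zero (h : ∀ b, b.length = n → ¬ P b) : wordCount P n = 0 := by
  have : {b : List Bool | b.length = n ∧ P b} = ∅ := Set.eq_empty_of_forall_notMem
    fun b hb => h b hb.1 hb.2
  simp [wordCount, this]

lemma wordCount_pos (b : List Bool) (hb : b.length = n) (hP : P b) : 0 < wordCount P n :=
  (Set.ncard_pos (finite_words P n)).2 ⟨b, hb, hP⟩

lemma wordCount_zero (h : P []) : wordCount P 0 = 1 := by
  have : {b : List Bool | b.length = 0 ∧ P b} = {[]} := by
    ext b
    simp only [Set.mem_ofPred_eq, Set.mem_singleton_iff, List.length_eq_zero_iff]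
    exact ⟨fun h => h.1, fun hb => ⟨hb, hb ▸ h⟩⟩
  rw [wordCount, this, Set.ncard_singleton]

/-- Counting through an injective map of words that shifts the length. -/
lemma wordCount_eq_of_map {m : ℕ} (f : List Bool → List Bool) (hf : Function.Injective f)
    (h : ∀ w, (w.length = m ∧ Q w) ↔ ∃ b, (b.length = n ∧ P b) ∧ f b = w) :
    wordCount P n = wordCount Q m := by
  unfold wordCount
  rw [← Set.ncard_image_of_injective _ hf]
  congr 1
  ext w
  exact (h w).symm

lemma wordCount_cons (e : Bool) (P : List Bool → Prop) (n : ℕ) :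
    wordCount P (n + 1) = wordCount (fun b => P (e :: b)) n + wordCount (fun b => P ((!e) :: b)) n := by
  rw [wordCount_eq_add (Q := fun b => P b ∧ b.head? = some e)
    (R := fun b => P b ∧ b.head? = some (!e))]
  · have key : ∀ x : Bool, wordCount (fun b => P b ∧ b.head? = some x) (n + 1) =
        wordCount (fun b => P (x :: b)) n := by
      intro x
      symm
      refine wordCount_eq_of_map (List.cons x) List.cons_injective fun w => ?_
      cases w with
      | nil => simp
      | cons y w => simp; aesop
    rw [key, key]
  · intro b hb
    cases b with
    | nil => simp at hb
    | cons x b => cases x <;> cases e <;> simp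
  · rintro b - ⟨-, h⟩ ⟨-, h'⟩
    rw [h] at h'
    cases e <;> simp at h'

lemma wordCount_snoc (P : List Bool → Prop) (n : ℕ) :
    wordCount (fun b => P b.dropLast) (n + 1) = 2 * wordCount P n := by
  rw [wordCount_eq_add (Q := fun b => P b.dropLast ∧ b.getLast? = some true)
    (R := fun b => P b.dropLast ∧ b.getLast? = some false), two_mul]
  · congr 1
    · symm
      refine wordCount_eq_of_map (· ++ [true]) (List.append_left_injective _) fun w => ?_
      rcases List.eq_nil_or_concat w with rfl | ⟨w, x, rfl⟩
      · simp
      · simp; aesop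
    · symm
      refine wordCount_eq_of_map (· ++ [false]) (List.append_left_injective _) fun w => ?_
      rcases List.eq_nil_or_concat w with rfl | ⟨w, x, rfl⟩
      · simp
      · simp; aesop
  · intro b hb
    rcases List.eq_nil_or_concat b with rfl | ⟨w, x, rfl⟩
    · simp at hb
    · cases x <;> simp
  · rintro b - ⟨-, h⟩ ⟨-, h'⟩
    rw [h] at h'
    simp at h'

lemma wordCount_tail (P : List Bool → Prop) (n : ℕ) :
    wordCount (fun b => P b.tail) (n + 1) = 2 * wordCount P n := by
  rw [wordCount_cons true, two_mul]; rfl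

end WordCount

/-! ### Extensions that avoid `k` -/

/-- The number of words `y` of length `n` such that `k` does not occur in `w ++ y`. -/
noncomputable def extCount (k w : List Bool) (n : ℕ) : ℕ := wordCount (fun y => ¬ k <:+: w ++ y) n

/-- The number of words of length `n` in which `k` does not occur. -/
noncomputable def avoidCount (k : List Bool) (n : ℕ) : ℕ := wordCount (fun y => ¬ k <:+: y) n

section

variable {k : List Bool}

lemma extCount_succ (e : Bool) (k w : List Bool) (n : ℕ) :
    extCount k w (n + 1) = extCount k (w ++ [e]) n + extCount k (w ++ [!e]) n := by
  unfold extCount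
  rw [wordCount_cons e]
  simp

lemma extCount_eq_zero {w : List Bool} (h : k <:+: w) (n : ℕ) : extCount k w n = 0 :=
  wordCount_eq_zero fun _ _ h' => h' (List.infix_append_of_infix_left h)

lemma extCount_nil (k : List Bool) (n : ℕ) : extCount k [] n = avoidCount k n := rfl

lemma extCount_le_avoidCount (k w : List Bool) (n : ℕ) : extCount k w n ≤ avoidCount k n :=
  wordCount_mono fun _ _ h h' => h (List.infix_append_of_infix_right h')

lemma extCount_succ_le (k w : List Bool) (n : ℕ) :
    extCount k w (n + 1) ≤ 2 * extCount k w n := by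
  unfold extCount
  rw [← wordCount_snoc]
  refine wordCount_mono fun b _ h h' => h (h'.trans ?_)
  exact ((List.prefix_append_right_inj w).2 (List.dropLast_prefix b)).isInfix

lemma extCount_add_le (k w : List Bool) (n j : ℕ) :
    extCount k w (n + j) ≤ 2 ^ j * extCount k w n := by
  induction j with
  | zero => simp
  | succ j ih =>
    calc extCount k w (n + j + 1) ≤ 2 * extCount k w (n + j) := extCount_succ_le ..
      _ ≤ 2 * (2 ^ j * extCount k w n) := by gcongr
      _ = _ := by ring

lemma avoidCount_add_le (k : List Bool) (n j : ℕ) :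
    avoidCount k (n + j) ≤ 2 ^ j * avoidCount k n := extCount_add_le k [] n j

/-- A run of a letter other than the last letter of `k` creates no occurrence of `k`. -/
lemma not_infix_replicate {k' : List Bool} {e : Bool} (hk : k = k' ++ [!e]) (j : ℕ) :
    ¬ k <:+: List.replicate j e := by
  intro h
  have : (!e) ∈ List.replicate j e := h.subset (by simp [hk])
  have := List.eq_of_mem_replicate this
  simp at this

/-- An occurrence that starts in `w` and leaves it would end inside the run, since the run is as
long as `k`; but the last letter of `k` is `!e`. Thus the run makes the past irrelevant. -/
lemma infix_append_replicate_append {k' : List Bool} {e : Bool} (hk : k = k' ++ [!e])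
    {w : List Bool} (hw : ¬ k <:+: w) (y : List Bool) :
    k <:+: w ++ List.replicate k.length e ++ y ↔ k <:+: List.replicate k.length e ++ y := by
  rw [List.append_assoc]
  refine ⟨fun h => ?_, List.infix_append_of_infix_right⟩
  rcases List.infix_append_iff.1 h with h | h | ⟨p, q, hpq, hp, hq⟩
  · exact absurd h hw
  · exact h
  · by_cases hq0 : q = []
    · subst hq0
      rw [List.append_nil] at hpq
      exact absurd (hpq ▸ hp.isInfix) hw
    · have hq1 : q <+: List.replicate k.length e :=
        List.prefix_of_prefix_length_le hq (List.prefix_append _ _) (by simp [hpq])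
      have hl : k.getLast? = q.getLast? := by
        rw [hpq, List.getLast?_append_of_ne_nil _ hq0]
      have hmem : (!e) ∈ q := List.mem_of_getLast? (by rw [← hl, hk]; simp)
      have := List.eq_of_mem_replicate (hq1.subset hmem)
      simp at this

lemma extCount_append_replicate {k' : List Bool} {e : Bool} (hk : k = k' ++ [!e])
    {w : List Bool} (hw : ¬ k <:+: w) (n : ℕ) :
    extCount k (w ++ List.replicate k.length e) n = extCount k (List.replicate k.length e) n :=
  wordCount_congr fun y _ => not_congr (infix_append_replicate_append hk hw y)

lemma extCount_pos {k' : List Bool} {e : Bool} (hk : k = k' ++ [!e])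
    {w : List Bool} (hw : ¬ k <:+: w) (n : ℕ) : 0 < extCount k w n := by
  have h : 0 < extCount k w (n + k.length) := by
    refine wordCount_pos (List.replicate k.length e ++ List.replicate n e) (by simp [add_comm]) ?_
    rw [← List.append_assoc, infix_append_replicate_append hk hw, List.replicate_append_replicate]
    exact not_infix_replicate hk _
  exact Nat.pos_of_mul_pos_left (h.trans_le (extCount_add_le k w n k.length))

lemma eq_append_not (hk : k ≠ []) : ∃ k' e, k = k' ++ [!e] :=
  ⟨k.dropLast, !(k.getLast hk), by simp [List.dropLast_append_getLast]⟩

lemma avoidCount_pos (hk : k ≠ []) (n : ℕ) : 0 < avoidCount k n := by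
  obtain ⟨k', e, h⟩ := eq_append_not hk
  exact extCount_pos h (w := []) (by simpa using hk) n

lemma avoidCount_zero (hk : k ≠ []) : avoidCount k 0 = 1 := wordCount_zero (by simpa using hk)

lemma iterate_append_singleton (e : Bool) (j : ℕ) (w : List Bool) :
    (fun w => w ++ [e])^[j] w = w ++ List.replicate j e := by
  induction j generalizing w with
  | zero => simp
  | succ j ih => rw [Function.iterate_succ_apply, ih]; simp [List.replicate_succ]

/-! ### Existence of the avoidance rate -/

/-- The ratios of the numbers of words that avoid `k` converge. -/
def HasAvoidRate (k : List Bool) : Prop :=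
  ∃ g : ℝ, Tendsto (fun n => (avoidCount k (n + 1) : ℝ) / avoidCount k n) atTop (𝓝 g)

lemma hasAvoidRate_of_dominated {k' : List Bool} {e : Bool} (hk : k = k' ++ [!e]) (C : ℕ)
    (hC : ∀ n, avoidCount k n ≤ C * extCount k (List.replicate k.length e) n) :
    HasAvoidRate k := by
  have hk0 : k ≠ [] := by simp [hk]
  have hCpos : 1 ≤ C := by
    have := (avoidCount_pos hk0 0).trans_le (hC 0)
    exact Nat.pos_of_mul_pos_right this
  have hC1 : (1 : ℝ) ≤ C := by exact_mod_cast hCpos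
  have h2 : (1 : ℝ) ≤ 2 ^ k.length := one_le_pow₀ (by norm_num)
  -- The choice of `δ` comes from ext(w, n + L) ≤ a(n + L) ≤ 2^L a(n) ≤ 2^L C ext(e^L, n).
  obtain ⟨g, hg⟩ := exists_tendsto_ratio (v := fun w n => (extCount k w n : ℝ))
    (α := fun w => w ++ [e]) (β := fun w => w ++ [!e]) (s₀ := List.replicate k.length e)
    (L := k.length) (δ := 1 / (2 ^ k.length * C))
    (fun w n => by exact_mod_cast extCount_succ e k w n) (fun _ _ => Nat.cast_nonneg _)
    (fun w => by exact_mod_cast extCount_succ_le k w 0)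
    (fun w => by
      by_cases hw : k <:+: w
      · exact .inl fun n => by simp [extCount_eq_zero hw]
      · refine .inr fun n => ?_
        rw [iterate_append_singleton, extCount_append_replicate hk hw])
    (fun n => by exact_mod_cast extCount_pos hk (not_infix_replicate hk _) n)
    (by positivity) (by rw [div_le_one (by positivity)]; nlinarith)
    (fun w n => by
      rw [div_mul_eq_mul_div, one_mul, div_le_iff₀ (by positivity)]
      have : extCount k w (n + k.length) ≤
          2 ^ k.length * (C * extCount k (List.replicate k.length e) n) :=
        (extCount_le_avoidCount ..).trans ((avoidCount_add_le ..).trans (by gcongr; exact hC n))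
      calc (extCount k w (n + k.length) : ℝ)
          ≤ 2 ^ k.length * (C * extCount k (List.replicate k.length e) n) := by exact_mod_cast this
        _ = _ := by ring)
  exact ⟨g, hg [] fun n => by exact_mod_cast avoidCount_pos hk0 n⟩

/-- The bridge `u` lets every word that avoids `k` follow the run safely, so domination holds with
constant `2 ^ u.length`. -/
lemma hasAvoidRate_of_bridge {k' : List Bool} {e : Bool} (hk : k = k' ++ [!e]) (u : List Bool)
    (hu : ∀ y, k <:+: List.replicate k.length e ++ (u ++ y) → k <:+: y) : HasAvoidRate k := by
  refine hasAvoidRate_of_dominated hk (2 ^ u.length) fun n => ?_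
  refine le_trans ?_ (extCount_add_le k _ n u.length)
  have hinj : Function.Injective (fun y => u ++ y) := List.append_right_injective u
  rw [← extCount_nil]
  unfold extCount wordCount
  rw [← Set.ncard_image_of_injective _ hinj]
  refine Set.ncard_le_ncard ?_ (finite_words _ _)
  rintro _ ⟨y, ⟨hy, hy'⟩, rfl⟩
  exact ⟨by simp [hy, add_comm], fun h => hy' (hu y h)⟩

lemma prefix_replicate_append_cons {e : Bool} {s i : ℕ} {z B : List Bool}
    (h : List.replicate s e ++ (!e) :: z <+: List.replicate i e ++ (!e) :: B) :
    s = i ∧ z <+: B := by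
  induction s generalizing i with
  | zero =>
    cases i with
    | zero => simpa using h
    | succ i => simp [List.replicate_succ] at h
  | succ s ih =>
    cases i with
    | zero => simp [List.replicate_succ] at h
    | succ i =>
      have := ih (i := i) (by simpa [List.replicate_succ] using h)
      exact ⟨by omega, this.2⟩

/-- An occurrence starting in the run must align its first `!e` with the `!e` that ends the run; any
other occurrence lies in `B`. -/
lemma infix_replicate_append_cons {e : Bool} {s i : ℕ} {z B : List Bool}
    (h : List.replicate s e ++ (!e) :: z <:+: List.replicate i e ++ (!e) :: B) :
    (s ≤ i ∧ z <+: B) ∨ List.replicate s e ++ (!e) :: z <:+: B := by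
  induction i with
  | zero =>
    rw [List.replicate_zero, List.nil_append, List.infix_cons_iff] at h
    refine h.imp (fun h => ?_) id
    have := prefix_replicate_append_cons (i := 0) h
    exact ⟨this.1.le, this.2⟩
  | succ i ih =>
    rw [List.replicate_succ, List.cons_append, List.infix_cons_iff] at h
    rcases h with h | h
    · have := prefix_replicate_append_cons (i := i + 1) h
      exact .inl ⟨this.1.le, this.2⟩
    · exact (ih h).imp (fun h => ⟨by omega, h.2⟩) id

lemma infix_of_infix_replicate_append {c : Bool} {j : ℕ} {z y : List Bool}
    (h : (!c) :: z <:+: List.replicate j c ++ y) : (!c) :: z <:+: y := by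
  induction j with
  | zero => simpa using h
  | succ j ih =>
    rw [List.replicate_succ, List.cons_append, List.infix_cons_iff] at h
    rcases h with h | h
    · simp at h
    · exact ih h

lemma eq_replicate_append (e : Bool) (k : List Bool) (h : (!e) ∈ k) :
    ∃ s z, k = List.replicate s e ++ (!e) :: z := by
  induction k with
  | nil => simp at h
  | cons x k ih =>
    by_cases hx : x = e
    · subst hx
      obtain ⟨s, z, rfl⟩ := ih (by simpa using h)
      exact ⟨s + 1, z, rfl⟩
    · exact ⟨0, k, by simp [Bool.eq_not_of_ne hx]⟩

/-- The words that begin with the complement of the letter of the run. -/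
lemma hasAvoidRate_of_head {k' z : List Bool} {e : Bool} (hk : k = k' ++ [!e])
    (hz : k = (!e) :: z) : HasAvoidRate k :=
  hasAvoidRate_of_bridge hk [] fun y h => by
    rw [List.nil_append] at h
    generalize k.length = j at h
    subst hz
    exact infix_of_infix_replicate_append h

/-- The bridge is a run of `!e` longer than `k`. An occurrence from the first run would place `z`,
which contains `e`, inside the bridge; and none starts in the bridge, as `k` begins with `e`. -/
lemma hasAvoidRate_of_mem {k' z : List Bool} {e : Bool} {s : ℕ} (hk : k = k' ++ [!e])
    (hz : k = List.replicate (s + 1) e ++ (!e) :: z) (he : e ∈ z) : HasAvoidRate k := by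
  refine hasAvoidRate_of_bridge hk (List.replicate (k.length + 1) (!e)) fun y h => ?_
  have hlen : z.length ≤ k.length := by simp [hz]; omega
  generalize k.length = j at h hlen
  subst hz
  rw [List.replicate_succ (a := !e), List.cons_append] at h
  rcases infix_replicate_append_cons h with ⟨-, h⟩ | h
  · have hp : z <+: List.replicate j (!e) :=
      List.prefix_of_prefix_length_le h (List.prefix_append _ _) (by simpa using hlen)
    have := List.eq_of_mem_replicate (hp.subset he)
    simp at this
  · have h' : (!(!e)) :: (List.replicate s e ++ (!e) :: z) <:+: List.replicate j (!e) ++ y := by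
      simpa [List.replicate_succ] using h
    simpa [List.replicate_succ] using infix_of_infix_replicate_append h'

/-- With bridge `!e, e, !e`, the single first `!e` is too short for the second run of `k`, and the
single `e` too short for the first. -/
lemma hasAvoidRate_of_two_runs {e : Bool} {s t : ℕ}
    (hz : k = List.replicate (s + 2) e ++ List.replicate (t + 2) (!e)) : HasAvoidRate k := by
  have hz' : k = List.replicate (s + 2) e ++ (!e) :: (!e) :: List.replicate t (!e) := by
    rw [hz]; rfl
  refine hasAvoidRate_of_bridge (e := e)
    (k' := List.replicate (s + 2) e ++ List.replicate (t + 1) (!e))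
    (by rw [hz, List.replicate_succ' (n := t + 1)]; simp) [!e, e, !e] fun y h => ?_
  generalize k.length = j at h
  subst hz'
  rcases infix_replicate_append_cons (B := e :: (!e) :: y) h with ⟨-, h⟩ | h
  · simp at h
  · rcases infix_replicate_append_cons (i := 1) h with ⟨h, -⟩ | h
    · omega
    · exact h

end

section

variable {k : List Bool}

lemma infix_cons_of_infix_replicate_append {e : Bool} {j : ℕ} {z y : List Bool}
    (h : e :: (!e) :: z <:+: List.replicate j e ++ y) : e :: (!e) :: z <:+: e :: y := by
  induction j with
  | zero => exact List.infix_cons (by simpa using h)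
  | succ j ih =>
    rw [List.replicate_succ, List.cons_append, List.infix_cons_iff] at h
    rcases h with h | h
    · cases j with
      | zero => exact List.IsPrefix.isInfix (by simpa using h)
      | succ j => simp [List.replicate_succ] at h
    · exact ih h

/-- No bridge exists: after an `e`, a long enough run of `!e` always completes `k`. Domination with
constant 2 comes instead from a(n+1) ≤ a(n) + b(n), b(n+2) ≥ b(n+1) + b(n) and b(n+1) ≤ 2b(n), which
yield a(n+2) ≤ 3b(n+1) ≤ 2b(n+2) by induction. -/
lemma hasAvoidRate_of_cons_run {e : Bool} {t : ℕ}
    (hz : k = e :: List.replicate (t + 2) (!e)) : HasAvoidRate k := by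
  have hk : k = (e :: List.replicate (t + 1) (!e)) ++ [!e] := by
    rw [hz, List.replicate_succ' (n := t + 1)]; simp
  have hz' : k = e :: (!e) :: (!e) :: List.replicate t (!e) := by rw [hz]; rfl
  have hrun := not_infix_replicate hk k.length
  set b := extCount k (List.replicate k.length e) with hb
  have hpos : ∀ n, 0 < b n := extCount_pos hk hrun
  have h1 : ∀ n, avoidCount k (n + 1) ≤ avoidCount k n + b n := by
    intro n
    rw [← extCount_nil, extCount_succ (!e), Bool.not_not]
    refine add_le_add (extCount_le_avoidCount ..) (wordCount_mono fun y _ h h' => h ?_)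
    rw [hz'] at h' ⊢
    exact infix_cons_of_infix_replicate_append h'
  have h2 : ∀ n, b (n + 2) ≥ b (n + 1) + b n := by
    intro n
    rw [hb, extCount_succ e, ← List.replicate_succ']
    refine add_le_add ?_ ?_
    · have hw : ¬ k <:+: [e] := not_infix_replicate hk 1
      rw [← extCount_append_replicate hk hw]; rfl
    · rw [extCount_succ e]
      refine le_trans (b := extCount k (List.replicate k.length e ++ [!e] ++ [e]) n)
        (wordCount_mono fun y _ h h' => h ?_) (Nat.le_add_right _ _)
      obtain ⟨j, hj⟩ : ∃ j, k.length = j + 1 := ⟨t + 2, by simp [hz]⟩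
      rw [hj] at h' ⊢
      rw [hz'] at h' ⊢
      rw [List.append_assoc, List.append_assoc] at h'
      rcases infix_replicate_append_cons (s := 1) (B := e :: y) h' with ⟨-, h'⟩ | h'
      · simp at h'
      · refine h'.trans ?_
        rw [List.replicate_succ', List.append_assoc]
        exact List.infix_append_right
  have h3 : ∀ n, b (n + 1) ≤ 2 * b n := fun n => extCount_succ_le ..
  refine hasAvoidRate_of_dominated hk 2 fun n => ?_
  have h0 : avoidCount k 0 = 1 := avoidCount_zero (by simp [hz])
  change avoidCount k n ≤ 2 * b n
  rcases n with _ | n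
  · have := hpos 0
    omega
  · induction n with
    | zero =>
      have := hpos 1
      have := avoidCount_add_le k 0 1
      simp only [zero_add] at *
      omega
    | succ n ih =>
      have := h1 (n + 1)
      have := h2 n
      have := h3 n
      change avoidCount k (n + 1 + 1) ≤ 2 * b (n + 2)
      omega

/-- The words are a run of `!e` followed by a run of `e`. After an `e` only one extension survives,
so domination fails and the rate is computed directly. -/
lemma avoidCount_pair (e : Bool) (n : ℕ) : avoidCount [e, !e] n = n + 1 := by
  have h1 : ∀ n, extCount [e, !e] [e] n = 1 := by
    intro n
    induction n with
    | zero => exact wordCount_zero (by simp [List.infix_cons_iff])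
    | succ n ih =>
      rw [extCount_succ e, extCount_eq_zero (k := [e, !e]) (w := [e] ++ [!e]) (List.infix_refl _), add_zero, ← ih]
      exact wordCount_congr fun y _ => by simp [List.infix_cons_iff (l₂ := e :: y)]
  induction n with
  | zero => exact avoidCount_zero (by simp)
  | succ n ih =>
    rw [← extCount_nil, extCount_succ (!e), Bool.not_not, ← ih]
    refine congrArg₂ _ (wordCount_congr fun y _ => ?_) (h1 n)
    simp [List.infix_cons_iff (l₂ := y)]

lemma hasAvoidRate_pair (e : Bool) : HasAvoidRate [e, !e] := by
  refine ⟨1, ?_⟩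
  have h : Tendsto (fun n : ℕ => 1 + 1 / ((n : ℝ) + 1)) atTop (𝓝 (1 + 0)) :=
    tendsto_one_div_add_atTop_nhds_zero_nat.const_add 1
  rw [add_zero] at h
  refine h.congr fun n => ?_
  rw [avoidCount_pair, avoidCount_pair]
  push_cast
  field_simp

lemma avoidCount_reverse (k : List Bool) (n : ℕ) : avoidCount k.reverse n = avoidCount k n := by
  refine wordCount_eq_of_map List.reverse List.reverse_injective fun w => ⟨fun h => ?_, ?_⟩
  · exact ⟨w.reverse, by simpa [List.reverse_infix] using h, by simp⟩
  · rintro ⟨b, hb, rfl⟩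
    rw [← List.reverse_infix]
    simpa using hb

lemma HasAvoidRate.of_reverse (h : HasAvoidRate k.reverse) : HasAvoidRate k := by
  simpa only [HasAvoidRate, avoidCount_reverse] using h

theorem hasAvoidRate (hk : k ≠ []) : HasAvoidRate k := by
  obtain ⟨k', e, hk'⟩ := eq_append_not hk
  obtain ⟨s, z, hz⟩ := eq_replicate_append e k (by simp [hk'])
  rcases s with _ | s
  · exact hasAvoidRate_of_head hk' hz
  by_cases he : e ∈ z
  · exact hasAvoidRate_of_mem hk' hz he
  obtain ⟨t, rfl⟩ : ∃ t, z = List.replicate t (!e) :=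
    ⟨z.length, List.eq_replicate_iff.2 ⟨rfl, fun x hx =>
      Bool.eq_not_of_ne fun h => he (h ▸ hx)⟩⟩
  rcases t with _ | t
  · rcases s with _ | s
    · exact hz ▸ hasAvoidRate_pair e
    · exact HasAvoidRate.of_reverse (hasAvoidRate_of_cons_run (e := !e) (t := s) (by simp [hz]))
  · rcases s with _ | s
    · exact hasAvoidRate_of_cons_run (t := t) (by rw [hz]; rfl)
    · exact hasAvoidRate_of_two_runs (s := s) (t := t) (by rw [hz]; rfl)

/-! ### First occurrences and codewords -/

/-- The number of words of length `n` in which `k` occurs as a suffix and nowhere else. -/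
noncomputable def firstCount (k : List Bool) (n : ℕ) : ℕ :=
  wordCount (fun w => k <:+ w ∧ ¬ k <:+: w.dropLast) n

lemma avoidCount_succ_add_firstCount (k : List Bool) (n : ℕ) :
    avoidCount k (n + 1) + firstCount k (n + 1) = 2 * avoidCount k n := by
  rw [avoidCount, avoidCount, ← wordCount_snoc, firstCount]
  symm
  refine wordCount_eq_add (fun b hb => ?_) (fun b _ h h' => h h'.1.isInfix)
  rcases List.eq_nil_or_concat b with rfl | ⟨w, x, rfl⟩
  · simp at hb
  · rw [List.concat_eq_append, List.dropLast_concat, List.infix_concat_iff]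
    tauto

lemma firstCount_eq_zero {n : ℕ} (h : n < k.length) : firstCount k n = 0 :=
  wordCount_eq_zero fun b hb hb' => by have := hb'.1.length_le; omega

lemma firstCount_le (hk : k ≠ []) (n : ℕ) : firstCount k (n + k.length) ≤ avoidCount k n := by
  unfold firstCount avoidCount wordCount
  rw [← Set.ncard_image_of_injective {b | b.length = n ∧ ¬ k <:+: b}
    (List.append_left_injective k)]
  refine Set.ncard_le_ncard ?_ ((finite_words _ _).image _)
  rintro _ ⟨hl, ⟨w, rfl⟩, h⟩
  refine ⟨w, ⟨by simpa using hl, fun h' => h ?_⟩, rfl⟩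
  rw [List.dropLast_append_of_ne_nil hk]
  exact List.infix_append_of_infix_left h'

lemma isInternalSubword_iff {w : List Bool} (hw : 2 ≤ w.length) :
    IsInternalSubword k w ↔ k <:+: w.tail.dropLast := by
  constructor
  · rintro ⟨x, y, hx, hy, rfl⟩
    refine ⟨x.tail, y.dropLast, ?_⟩
    rw [List.append_assoc x k y, List.tail_append_of_ne_nil hx, ← List.append_assoc x.tail k y,
      List.dropLast_append_of_ne_nil hy]
  · rintro ⟨x, y, h⟩
    obtain ⟨a, w, rfl⟩ := List.exists_cons_of_ne_nil (l := w) (by rintro rfl; simp at hw)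
    rcases List.eq_nil_or_concat w with rfl | ⟨w, b, rfl⟩
    · simp at hw
    · refine ⟨a :: x, y ++ [b], by simp, by simp, ?_⟩
      simp at h
      simp [← h]

lemma append_append_eq_of_prefix_of_suffix {w : List Bool} (h : 2 * k.length ≤ w.length)
    (hp : k <+: w) (hs : k <:+ w) : ∃ b, k ++ b ++ k = w := by
  obtain ⟨x, rfl⟩ := hp
  have : k <:+ x := List.suffix_of_suffix_length_le hs (List.suffix_append _ _) (by
    simp at h; omega)
  obtain ⟨b, rfl⟩ := this
  exact ⟨b, by simp⟩

/-- Prepend a letter to a word whose only `k` is its suffix. Either no new occurrence arises, or `k`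
becomes a prefix and the result is `k ++ b ++ k` with no internal `k`. -/
lemma numCodewords_add_firstCount (hk : k ≠ []) {n : ℕ} (hn : 1 ≤ n) :
    numCodewords k n + firstCount k (n + 2 * k.length) =
      2 * firstCount k (n + 2 * k.length - 1) := by
  have hL : 0 < k.length := List.length_pos_iff.2 hk
  have hnum : numCodewords k n = wordCount (fun w => k <+: w ∧ k <:+ w ∧ ¬ k <:+: w.tail.dropLast)
      (n + 2 * k.length) := by
    have : numCodewords k n = wordCount (fun b => ¬ IsInternalSubword k (k ++ b ++ k)) n := by
      unfold numCodewords wordCount codeOfLength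
      congr 1
      ext b
      simp [Nat.one_le_iff_ne_zero.1 hn]
    rw [this]
    refine wordCount_eq_of_map (fun b => k ++ b ++ k)
      (fun a b h => List.append_cancel_left (List.append_cancel_right h)) fun w => ⟨?_, ?_⟩
    · rintro ⟨hl, hp, hs, h⟩
      obtain ⟨b, rfl⟩ := append_append_eq_of_prefix_of_suffix (by omega) hp hs
      refine ⟨b, ⟨by simp at hl; omega, ?_⟩, rfl⟩
      rwa [isInternalSubword_iff (by omega)]
    · rintro ⟨b, ⟨hl, hb⟩, rfl⟩
      refine ⟨by simp [hl]; omega, ⟨b ++ k, by simp⟩, ⟨k ++ b, rfl⟩, ?_⟩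
      rwa [isInternalSubword_iff (by simp; omega)] at hb
  obtain ⟨m, hm⟩ : ∃ m, n + 2 * k.length = m + 1 := ⟨n + 2 * k.length - 1, by omega⟩
  rw [hnum, hm, Nat.add_sub_cancel, firstCount, firstCount, ← wordCount_tail]
  symm
  refine wordCount_eq_add (fun b hb => ?_) ?_
  · obtain ⟨x, w, rfl⟩ := List.exists_cons_of_ne_nil (l := b) (by rintro rfl; simp at hb)
    have hw : w.length = m := by simpa using hb
    have hw0 : w ≠ [] := by rintro rfl; simp at hw; omega
    have hsuf : k <:+ x :: w ↔ k <:+ w :=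
      ⟨fun h => List.suffix_of_suffix_length_le h (List.suffix_cons _ _) (by omega),
        fun h => h.trans (List.suffix_cons _ _)⟩
    have hpre : k <+: x :: w ↔ k <+: x :: w.dropLast := by
      constructor
      · intro h
        refine List.prefix_of_prefix_length_le h
          ((List.cons_prefix_cons).2 ⟨rfl, List.dropLast_prefix _⟩) ?_
        simp; omega
      · exact fun h => h.trans ((List.cons_prefix_cons).2 ⟨rfl, List.dropLast_prefix _⟩)
    rw [List.tail_cons, hsuf, List.dropLast_cons_of_ne_nil hw0, List.infix_cons_iff, ← hpre]
    tauto
  · rintro b hb ⟨hp, -, -⟩ ⟨-, h⟩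
    refine h (List.IsPrefix.isInfix (List.prefix_of_prefix_length_le hp (List.dropLast_prefix _) ?_))
    simp; omega

end

/-! ### Bounds for the rate and transfer to codewords -/

section

variable {k : List Bool}

/-- Of the `2 ^ p.length` branches leaving `w`, all but `p` are bounded by `avoidCount k n`. For `p
= k` the branch is dead, which forces the rate below 2. -/
lemma extCount_add_avoidCount_le (k w p : List Bool) (n : ℕ) :
    extCount k w (n + p.length) + avoidCount k n ≤
      2 ^ p.length * avoidCount k n + extCount k (w ++ p) n := by
  induction p generalizing w with
  | nil => simp [add_comm]
  | cons c p ih =>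
    have h1 := ih (w ++ [c])
    have h2 := (extCount_add_le k (w ++ [!c]) n p.length).trans
      (Nat.mul_le_mul_left (2 ^ p.length) (extCount_le_avoidCount k (w ++ [!c]) n))
    rw [List.append_assoc, List.singleton_append] at h1
    rw [List.length_cons, ← add_assoc, extCount_succ c, pow_succ']
    linarith

lemma avoidCount_add_length_le (k : List Bool) (n : ℕ) :
    avoidCount k (n + k.length) + avoidCount k n ≤ 2 ^ k.length * avoidCount k n := by
  have := extCount_add_avoidCount_le k [] k n
  rwa [List.nil_append, extCount_eq_zero (List.infix_refl k), add_zero] at this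

lemma tendsto_ratio_add {a : ℕ → ℝ} (ha : ∀ n, a n ≠ 0) {g : ℝ}
    (h : Tendsto (fun n => a (n + 1) / a n) atTop (𝓝 g)) (j : ℕ) :
    Tendsto (fun n => a (n + j) / a n) atTop (𝓝 (g ^ j)) := by
  induction j with
  | zero => simp [ha]
  | succ j ih =>
    rw [pow_succ']
    refine ((h.comp (tendsto_add_atTop_nat j)).mul ih).congr fun n => ?_
    have := ha (n + j)
    have := ha n
    simp only [Function.comp, ← add_assoc]
    field_simp

lemma rate_lt_two (hk : k ≠ []) {g : ℝ}
    (h : Tendsto (fun n => (avoidCount k (n + 1) : ℝ) / avoidCount k n) atTop (𝓝 g)) : g < 2 := by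
  have hpos : ∀ n, (0 : ℝ) < avoidCount k n := fun n => by exact_mod_cast avoidCount_pos hk n
  have hle : g ^ k.length ≤ 2 ^ k.length - 1 := by
    refine le_of_tendsto (tendsto_ratio_add (a := fun n => (avoidCount k n : ℝ))
      (fun n => (hpos n).ne') h k.length) (Eventually.of_forall fun n => ?_)
    rw [div_le_iff₀ (hpos n)]
    have : (avoidCount k (n + k.length) : ℝ) + avoidCount k n ≤ 2 ^ k.length * avoidCount k n := by
      exact_mod_cast avoidCount_add_length_le k n
    linarith
  exact lt_of_pow_lt_pow_left₀ k.length (by norm_num) (by linarith)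

lemma numCodewords_eq (hk : k ≠ []) {n : ℕ} (hn : 1 ≤ n) :
    (numCodewords k n : ℝ) = 4 * avoidCount k (n + (2 * k.length - 2))
      - 4 * avoidCount k (n + (2 * k.length - 2) + 1) + avoidCount k (n + (2 * k.length - 2) + 2) := by
  have hL : 0 < k.length := List.length_pos_iff.2 hk
  have h := numCodewords_add_firstCount hk hn
  obtain ⟨N, hN⟩ : ∃ N, N = n + (2 * k.length - 2) := ⟨_, rfl⟩
  rw [show n + 2 * k.length = N + 2 by omega, show N + 2 - 1 = N + 1 by omega] at h
  have h1 := avoidCount_succ_add_firstCount k N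
  have h2 := avoidCount_succ_add_firstCount k (N + 1)
  rw [← hN]
  have h' : (numCodewords k n : ℝ) + firstCount k (N + 2) = 2 * firstCount k (N + 1) := by
    exact_mod_cast h
  have h1' : (avoidCount k (N + 1) : ℝ) + firstCount k (N + 1) = 2 * avoidCount k N := by
    exact_mod_cast h1
  have h2' : (avoidCount k (N + 2) : ℝ) + firstCount k (N + 2) = 2 * avoidCount k (N + 1) := by
    exact_mod_cast h2
  linarith

lemma tendsto_numCodewords_ratio (hk : k ≠ []) {g : ℝ}
    (h : Tendsto (fun n => (avoidCount k (n + 1) : ℝ) / avoidCount k n) atTop (𝓝 g)) :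
    Tendsto (fun n => (numCodewords k (n + 1) : ℝ) / numCodewords k n) atTop (𝓝 g) := by
  have hpos : ∀ n, (avoidCount k n : ℝ) ≠ 0 := fun n => by exact_mod_cast (avoidCount_pos hk n).ne'
  have hg := rate_lt_two hk h
  obtain ⟨q, hq⟩ : ∃ q, q = 2 * k.length - 2 := ⟨_, rfl⟩
  have hc : Tendsto (fun n => (numCodewords k n : ℝ) / avoidCount k (n + q)) atTop
      (𝓝 ((2 - g) ^ 2)) := by
    have h1 := h.comp (tendsto_add_atTop_nat q)
    have h2 := (tendsto_ratio_add hpos h 2).comp (tendsto_add_atTop_nat q)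
    have h3 := ((h1.const_mul 4).const_sub 4).add h2
    rw [show 4 - 4 * g + g ^ 2 = (2 - g) ^ 2 by ring] at h3
    refine h3.congr' (eventually_atTop.2 ⟨1, fun n hn => ?_⟩)
    have := hpos (n + q)
    simp only [Function.comp]
    rw [numCodewords_eq hk hn, ← hq]
    field_simp
  have hne : (2 - g) ^ 2 ≠ 0 := pow_ne_zero _ (by linarith)
  have h4 := ((hc.comp (tendsto_add_atTop_nat 1)).div hc hne).mul
    (h.comp (tendsto_add_atTop_nat q))
  rw [div_self hne, one_mul] at h4
  refine h4.congr fun n => ?_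
  have e : n + 1 + q = n + q + 1 := by ring
  have := hpos (n + q)
  have := hpos (n + q + 1)
  simp only [Function.comp, Pi.div_apply, e]
  field_simp

/-- Bernoulli's inequality after factoring out `2 ^ (l + 2)`, together with `l + 2 ≤ 2 ^ (l + 1)`.
-/
lemma half_pow_mul_pow_ge (l : ℕ) :
    1 ≤ (1 / 2 : ℝ) ^ (l + 1) * (2 - (1 / 2) ^ (l + 1)) ^ (l + 2) := by
  have hb := one_add_mul_le_pow (a := -(1 / 2 : ℝ) ^ (l + 2))
    (by have : (1 / 2 : ℝ) ^ (l + 2) ≤ 1 := pow_le_one₀ (by norm_num) (by norm_num)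
        linarith) (l + 2)
  have hx : ((l : ℝ) + 2) * (1 / 2) ^ (l + 2) ≤ 1 / 2 := by
    have h : (l : ℝ) + 2 ≤ 2 ^ (l + 1) := by exact_mod_cast Nat.lt_two_pow_self (n := l + 1)
    rw [one_div, inv_pow, ← div_eq_mul_inv, div_le_iff₀ (by positivity)]
    calc (l : ℝ) + 2 ≤ 2 ^ (l + 1) := h
      _ = 2⁻¹ * 2 ^ (l + 2) := by ring
  have e : (2 - (1 / 2 : ℝ) ^ (l + 1)) ^ (l + 2) =
      2 ^ (l + 2) * (1 + -(1 / 2 : ℝ) ^ (l + 2)) ^ (l + 2) := by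
    rw [← mul_pow]; ring
  have e2 : (1 / 2 : ℝ) ^ (l + 1) * 2 ^ (l + 2) = 2 := by
    rw [pow_succ (2 : ℝ), ← mul_assoc, ← mul_pow]; norm_num
  rw [e, ← mul_assoc, e2]
  push_cast at hb
  linarith

/-- The loss at step m + 1 is at most a(m + 1 - L), by deleting the final `k`. Induction over the `l
+ 2 = L - 1` steps from there to `m` makes this at most a `(1 / 2) ^ (l + 1)` share of a(m). -/
lemma mul_avoidCount_le {l : ℕ} (hl : k.length = l + 3) (m : ℕ) :
    (2 - (1 / 2 : ℝ) ^ (l + 1)) * avoidCount k m ≤ avoidCount k (m + 1) := by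
  have hk : k ≠ [] := by rintro rfl; simp at hl
  set β : ℝ := 2 - (1 / 2 : ℝ) ^ (l + 1) with hβ
  have hβ0 : 0 ≤ β := by
    have : (1 / 2 : ℝ) ^ (l + 1) ≤ 1 := pow_le_one₀ (by norm_num) (by norm_num)
    linarith
  induction m using Nat.strong_induction_on with
  | _ m ih =>
    have hrec : (avoidCount k (m + 1) : ℝ) + firstCount k (m + 1) = 2 * avoidCount k m := by
      exact_mod_cast avoidCount_succ_add_firstCount k m
    suffices h : (firstCount k (m + 1) : ℝ) ≤ (1 / 2 : ℝ) ^ (l + 1) * avoidCount k m by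
      rw [hβ]; linarith
    by_cases hm : m + 1 < k.length
    · rw [firstCount_eq_zero hm, Nat.cast_zero]; positivity
    · obtain ⟨j, rfl⟩ : ∃ j, m = j + (l + 2) := ⟨m - (l + 2), by omega⟩
      have hstep : ∀ i ≤ l + 2, β ^ i * avoidCount k j ≤ avoidCount k (j + i) := by
        intro i
        induction i with
        | zero => simp
        | succ i ihi =>
          intro hi
          calc β ^ (i + 1) * avoidCount k j = β * (β ^ i * avoidCount k j) := by ring
            _ ≤ β * avoidCount k (j + i) := by gcongr; exact ihi (by omega)
            _ ≤ avoidCount k (j + i + 1) := ih _ (by omega)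
      have hf : (firstCount k (j + (l + 2) + 1) : ℝ) ≤ avoidCount k j := by
        have := firstCount_le hk j
        rw [hl] at this
        exact_mod_cast this
      calc (firstCount k (j + (l + 2) + 1) : ℝ) ≤ 1 * avoidCount k j := by rwa [one_mul]
        _ ≤ ((1 / 2 : ℝ) ^ (l + 1) * β ^ (l + 2)) * avoidCount k j := by
          gcongr; exact half_pow_mul_pow_ge l
        _ = (1 / 2 : ℝ) ^ (l + 1) * (β ^ (l + 2) * avoidCount k j) := by ring
        _ ≤ _ := by gcongr; exact hstep _ le_rfl

lemma two_sub_zpow_eq (l : ℕ) :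
    2 - (2 : ℝ) ^ ((2 : ℤ) - ((l + 3 : ℕ) : ℤ)) = 2 - (1 / 2) ^ (l + 1) := by
  rw [show (2 : ℤ) - ((l + 3 : ℕ) : ℤ) = -((l + 1 : ℕ) : ℤ) by push_cast; ring, zpow_neg,
    zpow_natCast, one_div, inv_pow]

/-- The numbers of codewords have a growth rate below `2`, which is at least `2 - 2 ^ (2 - L)`. -/
theorem exists_growthRate (hk : k ≠ []) :
    Tendsto (fun n : ℕ => (numCodewords k (n + 1) : ℝ) / numCodewords k n) atTop
      (𝓝 (growthRate k)) ∧ growthRate k < 2 ∧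
    (3 ≤ k.length → 2 - (2 : ℝ) ^ ((2 : ℤ) - (k.length : ℤ)) ≤ growthRate k) := by
  obtain ⟨g, hg⟩ := hasAvoidRate hk
  have hc := tendsto_numCodewords_ratio hk hg
  have hgr : growthRate k = g := hc.limUnder_eq
  rw [hgr]
  refine ⟨hc, rate_lt_two hk hg, fun h3 => ?_⟩
  obtain ⟨l, hl⟩ : ∃ l, k.length = l + 3 := ⟨k.length - 3, by omega⟩
  rw [hl, two_sub_zpow_eq]
  refine ge_of_tendsto hg (Eventually.of_forall fun n => ?_)
  rw [le_div_iff₀ (by exact_mod_cast avoidCount_pos hk n)]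
  exact mul_avoidCount_le hl n

end

/-! ### Cumulated counts and codeword lengths -/

section Growth

variable {c : ℕ → ℕ} {g : ℝ}

lemma exists_le_sum_of_ratio (hc0 : c 0 = 1)
    (hc : Tendsto (fun n => (c (n + 1) : ℝ) / c n) atTop (𝓝 g)) {r : ℝ} (hr1 : 1 < r)
    (hr : r < g) : ∃ K : ℝ, 0 < K ∧ ∀ n, K * r ^ n ≤ ∑ j ∈ Finset.range (n + 1), (c j : ℝ) := by
  obtain ⟨N, hN⟩ := eventually_atTop.1 (hc.eventually (lt_mem_nhds hr))
  have hr0 : 0 < r := by linarith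
  have hcpos : ∀ n ≥ N, (0 : ℝ) < c n := by
    intro n hn
    have h := hN n hn
    -- Division by zero gives ratio 0, so a ratio above `r` already forces `c n` to be positive.
    rcases (Nat.cast_nonneg (c n) : (0 : ℝ) ≤ c n).eq_or_lt with h0 | h0
    · rw [← h0, div_zero] at h
      linarith
    · exact h0
  have hge : ∀ n ≥ N, r ^ n ≤ r ^ N * c n := by
    intro n hn
    induction n, hn using Nat.le_induction with
    | base =>
      have : (1 : ℝ) ≤ c N := by exact_mod_cast hcpos N le_rfl
      exact le_mul_of_one_le_right (by positivity) this
    | succ n hn ih =>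
      have h := (lt_div_iff₀ (hcpos n hn)).1 (hN n hn)
      calc r ^ (n + 1) = r * r ^ n := by ring
        _ ≤ r * (r ^ N * c n) := by gcongr
        _ = r ^ N * (r * c n) := by ring
        _ ≤ _ := by gcongr
  have hle : ∀ n, (c n : ℝ) ≤ ∑ j ∈ Finset.range (n + 1), (c j : ℝ) := fun n =>
    Finset.single_le_sum (f := fun j => (c j : ℝ)) (fun j _ => Nat.cast_nonneg _)
      (Finset.mem_range.2 (Nat.lt_succ_self n))
  have hone : ∀ n, (1 : ℝ) ≤ ∑ j ∈ Finset.range (n + 1), (c j : ℝ) := fun n => by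
    have := Finset.single_le_sum (f := fun j => (c j : ℝ)) (fun j _ => Nat.cast_nonneg _)
      (Finset.mem_range.2 (Nat.succ_pos n))
    simpa [hc0] using this
  refine ⟨(r ^ N)⁻¹, by positivity, fun n => ?_⟩
  rw [inv_mul_le_iff₀ (by positivity)]
  rcases le_total N n with hn | hn
  · exact (hge n hn).trans (by gcongr; exact hle n)
  · calc r ^ n ≤ r ^ N * 1 := by rw [mul_one]; exact pow_le_pow_right₀ hr1.le hn
      _ ≤ _ := by gcongr; exact hone n

lemma exists_sum_le_of_ratio (hc : Tendsto (fun n => (c (n + 1) : ℝ) / c n) atTop (𝓝 g))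
    (hc0 : ∀ᶠ n in atTop, 0 < c n) {r : ℝ} (hr1 : 1 < r) (hr : g < r) :
    ∃ K : ℝ, ∀ n, ∑ j ∈ Finset.range (n + 1), (c j : ℝ) ≤ K * r ^ n := by
  obtain ⟨N, hN⟩ := eventually_atTop.1 ((hc.eventually (gt_mem_nhds hr)).and hc0)
  have hr0 : 0 < r := by linarith
  obtain ⟨A, hA⟩ : ∃ A : ℝ, A = ∑ j ∈ Finset.range (N + 1), (c j : ℝ) := ⟨_, rfl⟩
  have hA0 : 0 ≤ A := hA ▸ Finset.sum_nonneg fun j _ => Nat.cast_nonneg _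
  have hsmall : ∀ n ≤ N, (c n : ℝ) ≤ A * r ^ n := by
    intro n hn
    have : (c n : ℝ) ≤ A := hA ▸ Finset.single_le_sum (f := fun j => (c j : ℝ))
      (fun j _ => Nat.cast_nonneg _) (Finset.mem_range.2 (Nat.lt_succ_of_le hn))
    exact this.trans (le_mul_of_one_le_right hA0 (one_le_pow₀ hr1.le))
  have hall : ∀ n, (c n : ℝ) ≤ A * r ^ n := by
    intro n
    induction n with
    | zero => exact hsmall 0 (Nat.zero_le _)
    | succ n ih =>
      rcases Nat.lt_or_ge n N with h | h
      · exact hsmall _ h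
      · have := (div_lt_iff₀ (by exact_mod_cast (hN n h).2)).1 (hN n h).1
        calc (c (n + 1) : ℝ) ≤ r * c n := this.le
          _ ≤ r * (A * r ^ n) := by gcongr
          _ = _ := by ring
  refine ⟨A * r / (r - 1), fun n => ?_⟩
  have hr2 : 0 < r - 1 := by linarith
  calc ∑ j ∈ Finset.range (n + 1), (c j : ℝ) ≤ ∑ j ∈ Finset.range (n + 1), A * r ^ j :=
        Finset.sum_le_sum fun j _ => hall j
    _ = A * ((r ^ (n + 1) - 1) / (r - 1)) := by rw [← Finset.mul_sum, geom_sum_eq hr1.ne']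
    _ ≤ A * (r ^ (n + 1) / (r - 1)) := by gcongr; linarith
    _ = _ := by ring

lemma exists_length_mul_log_le (hc0 : c 0 = 1)
    (hc : Tendsto (fun n => (c (n + 1) : ℝ) / c n) atTop (𝓝 g)) {r : ℝ} (hr1 : 1 < r)
    (hr : r < g) : ∃ C : ℝ, ∀ l i : ℕ, ∑ j ∈ Finset.range l, c j ≤ i →
      l * Real.logb 2 r ≤ Real.logb 2 (i + 1) + C := by
  obtain ⟨K, hK, h⟩ := exists_le_sum_of_ratio hc0 hc hr1 hr
  -- The term `logb 2 r` pays for the sum stopping at `l - 1`; the absolute value covers `l = 0`.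
  refine ⟨|Real.logb 2 r - Real.logb 2 K|, fun l i hi => ?_⟩
  have hi0 : 0 ≤ Real.logb 2 ((i : ℝ) + 1) := Real.logb_nonneg (by norm_num) (by
    have : (0 : ℝ) ≤ i := Nat.cast_nonneg i
    linarith)
  rcases l with _ | l
  · simp only [Nat.cast_zero, zero_mul]; positivity
  · have h1 : K * r ^ l ≤ (i : ℝ) + 1 := by
      have : ∑ j ∈ Finset.range (l + 1), (c j : ℝ) ≤ i := by exact_mod_cast hi
      linarith [h l]
    have h2 := Real.logb_le_logb_of_le (b := 2) (by norm_num) (by positivity) h1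
    rw [Real.logb_mul hK.ne' (by positivity), Real.logb_pow] at h2
    have := le_abs_self (Real.logb 2 r - Real.logb 2 K)
    push_cast
    linarith

lemma exists_log_le_length_mul (hc : Tendsto (fun n => (c (n + 1) : ℝ) / c n) atTop (𝓝 g))
    (hc0 : ∀ᶠ n in atTop, 0 < c n) {r : ℝ} (hr1 : 1 < r) (hr : g < r) :
    ∃ C : ℝ, ∀ l i : ℕ, i < ∑ j ∈ Finset.range (l + 1), c j →
      Real.logb 2 (i + 1) ≤ l * Real.logb 2 r + C := by
  obtain ⟨K, h⟩ := exists_sum_le_of_ratio hc hc0 hr1 hr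
  refine ⟨Real.logb 2 K, fun l i hi => ?_⟩
  have h1 : (i : ℝ) + 1 ≤ K * r ^ l := by
    have : (i : ℝ) + 1 ≤ ∑ j ∈ Finset.range (l + 1), (c j : ℝ) := by exact_mod_cast hi
    linarith [h l]
  have hr0 : 0 < r ^ l := by positivity
  have hi0 : (0 : ℝ) < (i : ℝ) + 1 := by positivity
  have hK : 0 < K := pos_of_mul_pos_left (hi0.trans_le h1) hr0.le
  have h2 := Real.logb_le_logb_of_le (b := 2) (by norm_num) hi0 h1
  rw [Real.logb_mul hK.ne' hr0.ne', Real.logb_pow] at h2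
  linarith

lemma eventually_pos_of_ratio (hc : Tendsto (fun n => (c (n + 1) : ℝ) / c n) atTop (𝓝 g))
    (hg : 0 < g) : ∀ᶠ n in atTop, 0 < c n := by
  filter_upwards [hc.eventually (lt_mem_nhds hg)] with n hn
  rcases Nat.eq_zero_or_pos (c n) with h | h
  · simp [h] at hn
  · exact h

lemma exists_lt_sum_of_eventually_pos (hc : ∀ᶠ n in atTop, 0 < c n) (i : ℕ) :
    ∃ n, i < ∑ j ∈ Finset.range n, c j := by
  obtain ⟨N, hN⟩ := eventually_atTop.1 hc
  induction i with
  | zero =>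
    refine ⟨N + 1, (hN N le_rfl).trans_le ?_⟩
    exact Finset.single_le_sum (f := c) (fun j _ => Nat.zero_le _)
      (Finset.mem_range.2 (Nat.lt_succ_self N))
  | succ i ih =>
    obtain ⟨n, hn⟩ := ih
    refine ⟨max n N + 1, ?_⟩
    rw [Finset.sum_range_succ]
    have h1 : ∑ j ∈ Finset.range n, c j ≤ ∑ j ∈ Finset.range (max n N), c j :=
      Finset.sum_le_sum_of_subset (Finset.range_mono (le_max_left _ _))
    have := hN (max n N) (le_max_right _ _)
    omega

end Growth

/-! ### Optimal encoders, entropy and rank -/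

section Encoder

variable {k : List Bool} {A : Type*} [Fintype A]

lemma finite_codeOfLength (k : List Bool) (n : ℕ) : (codeOfLength k n).Finite :=
  (List.finite_length_eq Bool n).subset fun _ h => h.1

lemma numCodewords_zero (k : List Bool) : numCodewords k 0 = 1 := by
  have : codeOfLength k 0 = {[]} := by
    ext b
    simp [codeOfLength]
  rw [numCodewords, this, Set.ncard_singleton]

lemma exists_enum_codeOfLength (k : List Bool) (n : ℕ) :
    ∃ f : ℕ → List Bool, (∀ j < numCodewords k n, f j ∈ codeOfLength k n) ∧
      Set.InjOn f (Set.Iio (numCodewords k n)) := by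
  classical
  have hfin := finite_codeOfLength k n
  have hcard : numCodewords k n = hfin.toFinset.card := Set.ncard_eq_toFinset_card _ hfin
  let e := hfin.toFinset.equivFin
  refine ⟨fun j => if h : j < hfin.toFinset.card then (e.symm ⟨j, h⟩ : List Bool) else [], ?_, ?_⟩
  · intro j hj
    rw [hcard] at hj
    simp only [hj, dif_pos]
    exact hfin.mem_toFinset.1 (e.symm ⟨j, hj⟩).2
  · intro i hi j hj hij
    rw [Set.mem_Iio, hcard] at hi hj
    simp only [hi, hj, dif_pos] at hij
    simpa using e.symm.injective (Subtype.ext hij)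

lemma exists_antitone_enum (q : A → ℝ) :
    ∃ u : Fin (Fintype.card A) ≃ A, Antitone (fun i => q (u i)) := by
  let e := (Fintype.equivFin A).symm
  refine ⟨(Tuple.sort fun i => -q (e i)).trans e, fun i j hij => ?_⟩
  have := Tuple.monotone_sort (fun i => -q (e i)) hij
  simpa using this

theorem exists_isOptimalEncoder (hk : ∀ᶠ n in atTop, 0 < numCodewords k n) (q : A → ℝ) :
    ∃ φ : A → List Bool, IsOptimalEncoder k q φ := by
  obtain ⟨u, hu⟩ := exists_antitone_enum q
  have hlen : ∀ i : ℕ, ∃ n, ∑ j ∈ Finset.range n, numCodewords k j ≤ i ∧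
      i < ∑ j ∈ Finset.range (n + 1), numCodewords k j := by
    intro i
    classical
    have h := exists_lt_sum_of_eventually_pos hk i
    have hpos : Nat.find h ≠ 0 := by
      intro h0
      have := Nat.find_spec h
      rw [h0] at this
      simp at this
    obtain ⟨n, hn⟩ := Nat.exists_eq_succ_of_ne_zero hpos
    refine ⟨n, not_lt.1 (Nat.find_min h (by omega)), ?_⟩
    have := Nat.find_spec h
    rwa [hn] at this
  choose len hlen1 hlen2 using hlen
  choose f hf hinj using exists_enum_codeOfLength k
  have hlt : ∀ i, i - ∑ j ∈ Finset.range (len i), numCodewords k j < numCodewords k (len i) := by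
    intro i
    have h1 := hlen1 i
    have h2 := hlen2 i
    rw [Finset.sum_range_succ] at h2
    omega
  -- Rank `i` takes the codeword of length `len i` whose position is `i` minus the number of shorter
  -- codewords.
  obtain ⟨F, hF⟩ : ∃ F : ℕ → List Bool, F = fun i =>
      f (len i) (i - ∑ j ∈ Finset.range (len i), numCodewords k j) := ⟨_, rfl⟩
  have hFmem : ∀ i, F i ∈ codeOfLength k (len i) := fun i => hF ▸ hf _ _ (hlt i)
  have hFinj : Function.Injective F := by
    intro i j hij
    have hl : len i = len j := by
      rw [← (hFmem i).1, ← (hFmem j).1, hij]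
    have h1 := hlt i
    have h2 := hlen1 i
    rw [hF] at hij
    simp only [hl] at hij h1 h2
    have := hinj (len j) h1 (hlt j) hij
    have := hlen1 j
    omega
  refine ⟨fun a => F (u.symm a), ?_, ?_, u, hu, fun i => ?_⟩
  · intro a b hab
    exact u.symm.injective (Fin.ext (hFinj hab))
  · exact fun a => Set.mem_iUnion.2 ⟨_, hFmem _⟩
  · simp only [Equiv.symm_apply_apply, (hFmem i).1]
    exact ⟨hlen1 i, hlen2 i⟩

/-- The average of the binary logarithm of the rank. -/
noncomputable def avgLogRank {N : ℕ} (q : Fin N → ℝ) : ℝ := ∑ i, q i * Real.logb 2 ((i : ℕ) + 1)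

lemma entropy_comp_equiv {B : Type*} [Fintype B] (e : B ≃ A) (q : A → ℝ) :
    entropy (fun b => q (e b)) = entropy q :=
  Equiv.sum_comp e fun a => q a * Real.logb 2 (1 / q a)

/-- By monotonicity the first `i + 1` probabilities are at least `q i`, so the rank `i + 1` is at
most `1 / q i`. -/
lemma avgLogRank_le_entropy {N : ℕ} {q : Fin N → ℝ} (h0 : ∀ i, 0 ≤ q i) (h1 : ∑ i, q i = 1)
    (hq : Antitone q) : avgLogRank q ≤ entropy q := by
  refine Finset.sum_le_sum fun i _ => ?_
  rcases (h0 i).eq_or_lt with hi | hi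
  · simp [← hi]
  refine mul_le_mul_of_nonneg_left (Real.logb_le_logb_of_le (by norm_num) (by positivity) ?_) hi.le
  rw [le_div_iff₀ hi]
  calc ((i : ℕ) + 1 : ℝ) * q i = ∑ _j ∈ Finset.Iic i, q i := by simp
    _ ≤ ∑ j ∈ Finset.Iic i, q j := Finset.sum_le_sum fun j hj => hq (Finset.mem_Iic.1 hj)
    _ ≤ ∑ j, q j := Finset.sum_le_sum_of_subset_of_nonneg (Finset.subset_univ _) fun j _ _ => h0 j
    _ = 1 := h1

/-- The entropy exceeds the average logarithm of the rank at most by a doubly logarithmic term. -/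
lemma entropy_le_avgLogRank_add {N : ℕ} {q : Fin N → ℝ} (h0 : ∀ i, 0 ≤ q i)
    (h1 : ∑ i, q i = 1) : entropy q ≤ avgLogRank q + Real.logb 2 (1 + Real.log N) := by
  have hN : 0 < N := by
    rcases Nat.eq_zero_or_pos N with rfl | h
    · simp at h1
    · exact h
  have hlog : 0 ≤ Real.log N := Real.log_natCast_nonneg N
  -- Gibbs' inequality is applied against the weights `1 / ((i + 1) h)`; their total is at most 1
  -- because `h` bounds the harmonic number.
  obtain ⟨h, hh⟩ : ∃ h : ℝ, h = 1 + Real.log N := ⟨_, rfl⟩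
  have hpos : 0 < h := by linarith
  have hharm : ∑ i : Fin N, (((i : ℕ) : ℝ) + 1)⁻¹ ≤ h := by
    have := harmonic_le_one_add_log N
    rw [harmonic, ← Fin.sum_univ_eq_sum_range (fun i => ((↑(i + 1) : ℚ))⁻¹)] at this
    push_cast at this
    rwa [hh]
  have hterm : ∀ i : Fin N, q i * Real.logb 2 (1 / q i) ≤ q i * Real.logb 2 ((i : ℕ) + 1) +
      q i * Real.logb 2 h + (((((i : ℕ) : ℝ) + 1)⁻¹ / h) - q i) / Real.log 2 := by
    intro i
    have hl2 : 0 < Real.log 2 := Real.log_pos (by norm_num)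
    have hx : (0 : ℝ) < (i : ℕ) + 1 := by positivity
    rcases (h0 i).eq_or_lt with hi | hi
    · rw [← hi]
      simp only [zero_mul, zero_add, sub_zero]
      positivity
    have hb := Real.log_le_sub_one_of_pos (x := 1 / (q i * (((i : ℕ) + 1) * h))) (by positivity)
    rw [one_div, Real.log_inv, Real.log_mul hi.ne' (by positivity),
      Real.log_mul hx.ne' hpos.ne'] at hb
    have hb' := mul_le_mul_of_nonneg_left hb hi.le
    have e : q i * ((q i * (((i : ℕ) + 1) * h))⁻¹ - 1) = (((i : ℕ) : ℝ) + 1)⁻¹ / h - q i := by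
      field_simp
    rw [e] at hb'
    rw [one_div, Real.logb_inv]
    simp only [Real.logb]
    have : q i * -(Real.log (q i) / Real.log 2) =
        (q i * (-(Real.log (q i) + (Real.log ((i : ℕ) + 1) + Real.log h)))
          + q i * Real.log ((i : ℕ) + 1) + q i * Real.log h) / Real.log 2 := by
      field_simp; ring
    rw [this, mul_div_assoc', mul_div_assoc', ← add_div, ← add_div]
    refine div_le_div_of_nonneg_right ?_ hl2.le
    linarith
  calc entropy q ≤ ∑ i : Fin N, (q i * Real.logb 2 ((i : ℕ) + 1) +
        q i * Real.logb 2 h + (((((i : ℕ) : ℝ) + 1)⁻¹ / h) - q i) / Real.log 2) :=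
        Finset.sum_le_sum fun i _ => hterm i
    _ = avgLogRank q + Real.logb 2 h +
        ((∑ i : Fin N, (((i : ℕ) : ℝ) + 1)⁻¹) / h - 1) / Real.log 2 := by
        rw [Finset.sum_add_distrib, Finset.sum_add_distrib, ← Finset.sum_mul, ← Finset.sum_div,
          Finset.sum_sub_distrib, ← Finset.sum_div, h1, one_mul, avgLogRank]
    _ ≤ avgLogRank q + Real.logb 2 h := by
        have h3 : (∑ i : Fin N, (((i : ℕ) : ℝ) + 1)⁻¹) / h ≤ 1 := (div_le_one hpos).2 hharm
        have h4 : ((∑ i : Fin N, (((i : ℕ) : ℝ) + 1)⁻¹) / h - 1) / Real.log 2 ≤ 0 :=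
          div_nonpos_of_nonpos_of_nonneg (by linarith) (Real.log_nonneg (by norm_num))
        linarith
    _ = _ := by rw [hh]

end Encoder

/-! ### Blocks of the i.i.d. source -/

section Block

variable {U : Type*} [Fintype U] {p : U → ℝ}

/-- Written as a product with factor 1 off coordinate `i`, the summand factorizes and all other
coordinates sum to 1. -/
lemma sum_blockProb_mul (h1 : ∑ u, p u = 1) (t : ℕ) (i : Fin t) (f : U → ℝ) :
    ∑ v, blockProb p t v * f (v i) = ∑ u, p u * f u := by
  classical
  have h : ∀ v : Fin t → U, blockProb p t v * f (v i) =
      ∏ j, p (v j) * (if j = i then f (v j) else 1) := by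
    intro v
    rw [Finset.prod_mul_distrib, blockProb]
    simp
  have h2 := Finset.prod_univ_sum (fun _ : Fin t => (Finset.univ : Finset U))
    (fun j u => p u * (if j = i then f u else 1))
  rw [Fintype.piFinset_univ] at h2
  rw [Finset.sum_congr rfl fun v _ => h v, ← h2, Finset.prod_eq_single i]
  · simp
  · intro j _ hj
    simp [hj, h1]
  · simp

lemma sum_blockProb (h1 : ∑ u, p u = 1) (t : ℕ) : ∑ v, blockProb p t v = 1 := by
  classical
  have h2 := Finset.prod_univ_sum (fun _ : Fin t => (Finset.univ : Finset U)) (fun _ u => p u)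
  rw [Fintype.piFinset_univ] at h2
  simp only [blockProb]
  rw [← h2]
  simp [h1]

lemma blockProb_nonneg {V : Type*} {q : V → ℝ} (h0 : ∀ u, 0 ≤ q u) (t : ℕ) (v : Fin t → V) :
    0 ≤ blockProb q t v :=
  Finset.prod_nonneg fun i _ => h0 (v i)

lemma entropy_blockProb (h1 : ∑ u, p u = 1) (t : ℕ) :
    entropy (blockProb p t) = t * entropy p := by
  have h : ∀ v : Fin t → U, blockProb p t v * Real.logb 2 (1 / blockProb p t v) =
      ∑ i, blockProb p t v * Real.logb 2 (1 / p (v i)) := by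
    intro v
    rw [← Finset.mul_sum]
    by_cases hv : ∃ i, p (v i) = 0
    · obtain ⟨i, hi⟩ := hv
      have : blockProb p t v = 0 := Finset.prod_eq_zero (Finset.mem_univ i) hi
      simp [this]
    · push Not at hv
      simp only [one_div, Real.logb_inv, Finset.sum_neg_distrib]
      rw [blockProb, ← Real.logb_prod _ _ fun i _ => hv i]
  rw [entropy, Finset.sum_congr rfl fun v _ => h v, Finset.sum_comm]
  rw [Finset.sum_congr rfl fun i _ => sum_blockProb_mul h1 t i fun u => Real.logb 2 (1 / p u)]
  simp [entropy]

lemma entropy_nonneg (h0 : ∀ u, 0 ≤ p u) (h1 : ∑ u, p u = 1) : 0 ≤ entropy p := by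
  refine Finset.sum_nonneg fun u _ => ?_
  rcases (h0 u).eq_or_lt with hu | hu
  · simp [← hu]
  have : p u ≤ 1 := h1 ▸ Finset.single_le_sum (fun v _ => h0 v) (Finset.mem_univ u)
  exact mul_nonneg hu.le (Real.logb_nonneg (by norm_num) ((one_le_div hu).2 this))

variable {k : List Bool}

lemma mul_log_le_of_isOptimalEncoder {A : Type*} [Fintype A] {q : A → ℝ} (h0 : ∀ a, 0 ≤ q a)
    (h1 : ∑ a, q a = 1) {φ : A → List Bool} (hφ : IsOptimalEncoder k q φ) {r C : ℝ}
    (hC : ∀ l i : ℕ, ∑ j ∈ Finset.range l, numCodewords k j ≤ i →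
      l * Real.logb 2 r ≤ Real.logb 2 (i + 1) + C) :
    (avgLength k q φ - k.length) * Real.logb 2 r ≤ entropy q + C := by
  obtain ⟨-, -, u, hu, hlen⟩ := hφ
  have hs : ∑ i, q (u i) = 1 := by rw [Equiv.sum_comp u q, h1]
  have hr := avgLogRank_le_entropy (fun i => h0 (u i)) hs hu
  rw [entropy_comp_equiv u q] at hr
  calc (avgLength k q φ - k.length) * Real.logb 2 r
      = ∑ i, q (u i) * ((φ (u i)).length * Real.logb 2 r) := by
        rw [avgLength, add_sub_cancel_left, ← Equiv.sum_comp u, Finset.sum_mul]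
        exact Finset.sum_congr rfl fun i _ => mul_assoc _ _ _
    _ ≤ ∑ i, q (u i) * (Real.logb 2 ((i : ℕ) + 1) + C) :=
        Finset.sum_le_sum fun i _ => mul_le_mul_of_nonneg_left (hC _ _ (hlen i).1) (h0 _)
    _ = avgLogRank (fun i => q (u i)) + C := by
        simp only [mul_add, Finset.sum_add_distrib]
        rw [← Finset.sum_mul, hs, one_mul, avgLogRank]
    _ ≤ _ := by linarith

lemma le_mul_log_of_isOptimalEncoder {A : Type*} [Fintype A] {q : A → ℝ} (h0 : ∀ a, 0 ≤ q a)
    (h1 : ∑ a, q a = 1) {φ : A → List Bool} (hφ : IsOptimalEncoder k q φ) {r C : ℝ}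
    (hC : ∀ l i : ℕ, i < ∑ j ∈ Finset.range (l + 1), numCodewords k j →
      Real.logb 2 (i + 1) ≤ l * Real.logb 2 r + C) :
    entropy q - Real.logb 2 (1 + Real.log (Fintype.card A)) - C ≤
      (avgLength k q φ - k.length) * Real.logb 2 r := by
  obtain ⟨-, -, u, hu, hlen⟩ := hφ
  have hs : ∑ i, q (u i) = 1 := by rw [Equiv.sum_comp u q, h1]
  have hr := entropy_le_avgLogRank_add (fun i => h0 (u i)) hs
  rw [entropy_comp_equiv u q] at hr
  have h : avgLogRank (fun i => q (u i)) ≤ (avgLength k q φ - k.length) * Real.logb 2 r + C :=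
    calc avgLogRank (fun i => q (u i))
        ≤ ∑ i, q (u i) * ((φ (u i)).length * Real.logb 2 r + C) :=
          Finset.sum_le_sum fun i _ => mul_le_mul_of_nonneg_left (hC _ _ (hlen i).2) (h0 _)
      _ = ∑ i, q (u i) * ((φ (u i)).length * Real.logb 2 r) + C := by
          simp only [mul_add, Finset.sum_add_distrib]
          rw [← Finset.sum_mul, hs, one_mul]
      _ = _ := by
          rw [avgLength, add_sub_cancel_left, ← Equiv.sum_comp u, Finset.sum_mul]
          simp only [mul_assoc]
  linarith

lemma tendsto_logb_affine_div {c : ℝ} (hc : 0 ≤ c) :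
    Tendsto (fun t : ℕ => Real.logb 2 (1 + t * c) / t) atTop (𝓝 0) := by
  have h1 : Tendsto (fun t : ℕ => Real.log (t : ℝ) / t) atTop (𝓝 0) :=
    (Real.isLittleO_log_id_atTop.tendsto_div_nhds_zero).comp tendsto_natCast_atTop_atTop
  have h2 : Tendsto (fun t : ℕ => Real.log (1 + c) / (t : ℝ)) atTop (𝓝 0) :=
    tendsto_const_div_atTop_nhds_zero_nat _
  have h3 := (h1.add h2).div_const (Real.log 2)
  rw [add_zero, zero_div] at h3
  refine tendsto_of_tendsto_of_tendsto_of_le_of_le' tendsto_const_nhds h3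
    (Eventually.of_forall fun t => ?_) (eventually_atTop.2 ⟨1, fun t ht => ?_⟩)
  · have : 0 ≤ (t : ℝ) * c := by positivity
    exact div_nonneg (Real.logb_nonneg (by norm_num) (by linarith)) (Nat.cast_nonneg t)
  · have ht' : (1 : ℝ) ≤ t := by exact_mod_cast ht
    have hlog : Real.log (1 + t * c) ≤ Real.log t + Real.log (1 + c) := by
      rw [← Real.log_mul (by positivity) (by positivity)]
      exact Real.log_le_log (by positivity) (by nlinarith)
    rw [Real.logb, div_right_comm, ← add_div]
    have : 0 < Real.log 2 := Real.log_pos (by norm_num)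
    gcongr

lemma tendsto_div_logb {g : ℝ} (hg : 1 < g) (H : ℝ) :
    Tendsto (fun r => H / Real.logb 2 r) (𝓝 g) (𝓝 (H / Real.logb 2 g)) := by
  have hc : Tendsto (fun r => Real.logb 2 r) (𝓝 g) (𝓝 (Real.logb 2 g)) :=
    (Real.continuousAt_log (by linarith)).tendsto.div_const _
  exact tendsto_const_nhds.div hc (Real.logb_pos (by norm_num) hg).ne'

/-- The length estimates hold only with a base `r` strictly above or below `g`. Continuity of `H /
logb 2 r` at `g` lets `r` be fixed before `t → ∞`. -/
theorem perLetterLengthTendsto (h0 : ∀ u, 0 ≤ p u) (h1 : ∑ u, p u = 1) {g : ℝ} (hg : 1 < g)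
    (hc : Tendsto (fun n : ℕ => (numCodewords k (n + 1) : ℝ) / numCodewords k n) atTop (𝓝 g)) :
    PerLetterLengthTendsto k p (entropy p / Real.logb 2 g) := by
  have hev := eventually_pos_of_ratio hc (by linarith)
  refine ⟨fun t => exists_isOptimalEncoder hev _, fun φ hφ => ?_⟩
  have hL : Tendsto (fun t : ℕ => (k.length : ℝ) / (t : ℝ)) atTop (𝓝 0) :=
    tendsto_const_div_atTop_nhds_zero_nat _
  refine tendsto_order.2 ⟨fun a ha => ?_, fun b hb => ?_⟩
  · obtain ⟨r, hra, hr⟩ := ((((tendsto_div_logb hg (entropy p)).eventually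
      (lt_mem_nhds ha)).filter_mono nhdsWithin_le_nhds).and
        (self_mem_nhdsWithin (s := Set.Ioi g))).exists
    have hr : g < r := hr
    have hr1 : 1 < r := hg.trans hr
    have hlr : 0 < Real.logb 2 r := Real.logb_pos (by norm_num) hr1
    obtain ⟨C, hC⟩ := exists_log_le_length_mul hc hev hr1 hr
    have hC' : Tendsto (fun t : ℕ => C / (t : ℝ)) atTop (𝓝 0) :=
      tendsto_const_div_atTop_nhds_zero_nat _
    have hlim := ((((tendsto_logb_affine_div
      (Real.log_natCast_nonneg (Fintype.card U))).const_sub (entropy p)).sub hC').div_const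
        (Real.logb 2 r)).add hL
    rw [sub_zero, sub_zero, add_zero] at hlim
    filter_upwards [hlim.eventually (lt_mem_nhds hra), eventually_ge_atTop 1] with t ht ht1
    refine ht.trans_le ?_
    have ht0 : (0 : ℝ) < t := by exact_mod_cast ht1
    have key := le_mul_log_of_isOptimalEncoder (blockProb_nonneg h0 t) (sum_blockProb h1 t)
      (hφ t) hC
    rw [entropy_blockProb h1, Fintype.card_fun, Fintype.card_fin, Nat.cast_pow,
      Real.log_pow] at key
    rw [← le_sub_iff_add_le, ← sub_div, div_le_iff₀ hlr, div_mul_eq_mul_div, le_div_iff₀ ht0]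
    refine le_trans (le_of_eq ?_) key
    field_simp
  · obtain ⟨r, ⟨hrb, hr1⟩, hr⟩ := (((((tendsto_div_logb hg (entropy p)).eventually
      (gt_mem_nhds hb)).and (lt_mem_nhds hg)).filter_mono nhdsWithin_le_nhds).and
        (self_mem_nhdsWithin (s := Set.Iio g))).exists
    have hr : r < g := hr
    have hlr : 0 < Real.logb 2 r := Real.logb_pos (by norm_num) hr1
    obtain ⟨C, hC⟩ := exists_length_mul_log_le (numCodewords_zero k) hc hr1 hr
    have hC' : Tendsto (fun t : ℕ => C / (t : ℝ)) atTop (𝓝 0) :=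
      tendsto_const_div_atTop_nhds_zero_nat _
    have hlim := ((hC'.const_add (entropy p)).div_const (Real.logb 2 r)).add hL
    rw [add_zero, add_zero] at hlim
    filter_upwards [hlim.eventually (gt_mem_nhds hrb), eventually_ge_atTop 1] with t ht ht1
    refine lt_of_le_of_lt ?_ ht
    have ht0 : (0 : ℝ) < t := by exact_mod_cast ht1
    have key := mul_log_le_of_isOptimalEncoder (blockProb_nonneg h0 t) (sum_blockProb h1 t)
      (hφ t) hC
    rw [entropy_blockProb h1] at key
    rw [← sub_le_iff_le_add, ← sub_div, le_div_iff₀ hlr, div_mul_eq_mul_div, div_le_iff₀ ht0]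
    refine key.trans (le_of_eq ?_)
    field_simp

end Block

end UDOOC

theorem mainTheorem8 {U : Type*} [Fintype U] (p : U → ℝ)
    (hp_nonneg : ∀ u, 0 ≤ p u) (hp_sum : ∑ u, p u = 1) (hp_nontrivial : ∀ u, p u < 1) :
    (∀ k : List Bool, k ≠ [] → 1 < UDOOC.growthRate k →
      Tendsto (fun n : ℕ => (UDOOC.numCodewords k (n + 1) : ℝ) / (UDOOC.numCodewords k n : ℝ))
        atTop (𝓝 (UDOOC.growthRate k)) ∧
      (∃ l : ℝ, UDOOC.PerLetterLengthTendsto k p l ∧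
        l ≤ UDOOC.entropy p / Real.logb 2 (UDOOC.growthRate k)) ∧
      (3 ≤ k.length →
        UDOOC.entropy p / Real.logb 2 (UDOOC.growthRate k) ≤
          UDOOC.entropy p / Real.logb 2 (2 - (2 : ℝ) ^ ((2 : ℤ) - (k.length : ℤ))))) ∧
    (∀ ε : ℝ, 0 < ε → ∃ L₀ : ℕ, ∀ k : List Bool, L₀ ≤ k.length →
      ∃ l : ℝ, UDOOC.PerLetterLengthTendsto k p l ∧ |l - UDOOC.entropy p| < ε) := by
  have hH := UDOOC.entropy_nonneg hp_nonneg hp_sum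
  have hβ : ∀ L : ℕ, 3 ≤ L → 1 < 2 - (2 : ℝ) ^ ((2 : ℤ) - (L : ℤ)) := by
    intro L hL
    obtain ⟨l, rfl⟩ : ∃ l, L = l + 3 := ⟨L - 3, by omega⟩
    rw [UDOOC.two_sub_zpow_eq]
    have : (1 / 2 : ℝ) ^ (l + 1) < 1 := pow_lt_one₀ (by norm_num) (by norm_num) (by omega)
    linarith
  have hle : ∀ k : List Bool, k ≠ [] → 3 ≤ k.length →
      UDOOC.entropy p / Real.logb 2 (UDOOC.growthRate k) ≤
        UDOOC.entropy p / Real.logb 2 (2 - (2 : ℝ) ^ ((2 : ℤ) - (k.length : ℤ))) := by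
    intro k hk h3
    have hb := hβ k.length h3
    exact div_le_div_of_nonneg_left hH (Real.logb_pos (by norm_num) hb)
      (Real.logb_le_logb_of_le (by norm_num) (by linarith) ((UDOOC.exists_growthRate hk).2.2 h3))
  refine ⟨fun k hk hg => ?_, fun ε hε => ?_⟩
  · have hc := (UDOOC.exists_growthRate hk).1
    -- The first inequality of (a) holds with equality.
    exact ⟨hc, ⟨_, UDOOC.perLetterLengthTendsto hp_nonneg hp_sum hg hc, le_rfl⟩, hle k hk⟩
  · have hlim : Tendsto (fun l : ℕ => 2 - (1 / 2 : ℝ) ^ (l + 1)) atTop (𝓝 2) := by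
      have := ((tendsto_pow_atTop_nhds_zero_of_lt_one (r := (1 / 2 : ℝ)) (by norm_num)
        (by norm_num)).comp (tendsto_add_atTop_nat 1)).const_sub 2
      simpa using this
    have hlim2 := (UDOOC.tendsto_div_logb (g := 2) (by norm_num) (UDOOC.entropy p)).comp hlim
    rw [Real.logb_self_eq_one (by norm_num), div_one] at hlim2
    obtain ⟨N, hN⟩ := eventually_atTop.1
      (hlim2.eventually (gt_mem_nhds (lt_add_of_pos_right (UDOOC.entropy p) hε)))
    refine ⟨N + 3, fun k hkL => ?_⟩
    have hk : k ≠ [] := by rintro rfl; simp at hkL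
    obtain ⟨hc, h2, h3⟩ := UDOOC.exists_growthRate hk
    have hg : 1 < UDOOC.growthRate k := (hβ k.length (by omega)).trans_le (h3 (by omega))
    refine ⟨_, UDOOC.perLetterLengthTendsto hp_nonneg hp_sum hg hc, ?_⟩
    have hlog := Real.logb_pos (b := 2) (by norm_num) hg
    -- Growth rate below 2 keeps the limit at or above the entropy; the bound from `hle` keeps it
    -- below `entropy p + ε`.
    have hlog1 : Real.logb 2 (UDOOC.growthRate k) ≤ 1 := by
      rw [← Real.logb_self_eq_one (b := 2) (by norm_num)]
      exact Real.logb_le_logb_of_le (by norm_num) (by linarith) h2.le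
    have hlow : UDOOC.entropy p ≤ UDOOC.entropy p / Real.logb 2 (UDOOC.growthRate k) :=
      le_div_self hH hlog hlog1
    have hup := hle k hk (by omega)
    obtain ⟨l, hl⟩ : ∃ l, k.length = l + 3 := ⟨k.length - 3, by omega⟩
    have hNl : UDOOC.entropy p / Real.logb 2 (2 - (1 / 2 : ℝ) ^ (l + 1)) <
        UDOOC.entropy p + ε := hN l (by omega)
    rw [hl, UDOOC.two_sub_zpow_eq] at hup
    rw [abs_lt]
    constructor <;> linarith
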